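/- **Definitions.** A CNF is a finite set of clauses, a clause a finite set of literals; $\mathrm{var}(\varphi)$ is the set of variables occurring in $\varphi$. The incidence graph of $\varphi$ has the variables and the clauses of $\varphi$ as vertices, a variable being adjacent to the clauses in which it occurs; its treewidth is the incidence treewidth $\mathrm{itw}(\varphi)$. A $\wedge_d$-FBDD is a finite DAG $B$ with a single source and at most one sink for each label $\mathbf 0,\mathbf 1$, in which each non-sink node has two outgoing edges (possibly to the same child) and is either a conjunction node or a decision node labelled by a variable, with outgoing edges labelled $0$ and $1$. The sets of variables occurring below the two children of a conjunction node are disjoint, and no directed path joins two decision nodes with the same variable. A sink $\mathbf 1$ accepts the empty assignment and a sink $\mathbf 0$ accepts nothing; a decision node for $x$ accepts $\mathbf a\cup\{(x,i)\}$ for each $\mathbf a$ accepted by its $i$-child; a conjunction node accepts all unions $\mathbf a_0\cup\mathbf a_1$ with $\mathbf a_i$ accepted by its $i$-th child. $B$ represents $\varphi$ if $B$ and $\varphi$ have the same variables and the assignments satisfying $\varphi$ are exactly those extending an assignment accepted by the source of $B$. The size $|B|$ is the number of nodes. $B$ is a $\wedge_d$-OBDD if for some linear order of the variables, the labels of the decision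 nodes increase along every directed path. For a finite graph $G$, $\mathrm{tw}(G)$ is its treewidth, and the linear special induced matching width $\mathrm{lsimw}(G)$ is the minimum, over all linear orders $\pi$ of $V(G)$, of the largest size of an induced matching of $G$ such that, for some prefix $\pi_0$ of $\pi$, each edge of the matching has exactly one end in $\pi_0$. For a finite graph $G$ without isolated vertices, $\psi(G)$ is the CNF over two disjoint copies $\{v[1]\}$, $\{v[2]\}$ of $V(G)$ with the clauses $(u[1]\vee v[2])$ and $(v[1]\vee u[2])$ for each edge $\{u,v\}$ of $G$, together with the two clauses $\bigvee_{v\in V(G)}\neg v[1]$ and $\bigvee_{v\in V(G)}\neg v[2]$. **Theorem 3.1.** There are a constant $c>0$ and an infinite set $K$ of natural numbers such that for every $k\in K$ there are infinitely many $n$ for which there is a graph $G$ with $n$ vertices and without isolated vertices such that - $\mathrm{tw}(G)\le k$ and $\mathrm{lsimw}(G)\ge c\,k\log n$; - the CNF $\varphi=\psi(G)$ satisfies $\mathrm{itw}(\varphi)\le k$; - every $\wedge_d$-OBDD $B$ representing $\varphi$ has size $|B|\ge|\mathrm{var}(\varphi)|^{c\cdot k}$. In particular, for every $k\in K$ there are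 infinitely many CNFs $\varphi$, with unboundedly many variables, such that $\mathrm{itw}(\varphi)\le k$ and every $\wedge_d$-OBDD representing $\varphi$ has size at least $|\mathrm{var}(\varphi)|^{c\cdot k}$. -/

import Mathlib

/-! ### Treewidth -/

/-- A tree decomposition of a graph `G`: a finite tree `tree` and a bag of vertices of `G` for each
of its nodes, such that every vertex and every edge is contained in a bag and, for every vertex `v`,
the nodes whose bag contains `v` induce a connected subgraph of the tree. -/
structure TreeDecomposition {V : Type*} (G : SimpleGraph V) where
  Node : Type
  finite_node : Finite Node
  tree : SimpleGraph Node
  isTree : tree.IsTree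
  bag : Node → Finset V
  vertex_mem : ∀ v : V, ∃ t, v ∈ bag t
  edge_mem : ∀ u v : V, G.Adj u v → ∃ t, u ∈ bag t ∧ v ∈ bag t
  connected : ∀ v : V, (tree.induce {t | v ∈ bag t}).Connected

/-- The treewidth of a finite graph: the least `w` such that some tree decomposition has all its
bags of size at most `w + 1`. -/
noncomputable def treewidth {V : Type*} [Finite V] (G : SimpleGraph V) : ℕ :=
  sInf {w : ℕ | ∃ D : TreeDecomposition G, ∀ t, (D.bag t).card ≤ w + 1}

/-! ### Linear special induced matching width -/

/-- `M` is an induced matching of `G`: distinct edges of `M` share no vertex, and the only edges of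
`G` between vertices covered by `M` are those of `M`. -/
def IsInducedMatching {V : Type*} {G : SimpleGraph V} (M : G.Subgraph) : Prop :=
  M.IsMatching ∧ M.IsInduced

/-- `M` crosses the linear order `π` of the vertices: there is a prefix `S` of `π` such that every
edge of `M` has one end in `S` and the other end outside `S`. -/
def Crosses {V : Type*} {G : SimpleGraph V} (M : G.Subgraph) (π : LinearOrder V) : Prop :=
  ∃ S : Set V, (∀ u ∈ S, ∀ v, π.le v u → v ∈ S) ∧ ∀ u v, M.Adj u v → (u ∈ S ↔ v ∉ S)

/-- The largest size (number of edges) of an induced matching of `G` that crosses `π`. -/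
noncomputable def orderLsimWidth {V : Type*} [Finite V] (G : SimpleGraph V)
    (π : LinearOrder V) : ℕ :=
  sSup {m : ℕ | ∃ M : G.Subgraph, IsInducedMatching M ∧ Crosses M π ∧ M.edgeSet.ncard = m}

/-- The linear special induced matching width of `G`: the minimum of `orderLsimWidth G π` over all
linear orders `π` of the vertices. -/
noncomputable def lsimWidth {V : Type*} [Finite V] (G : SimpleGraph V) : ℕ :=
  ⨅ π : LinearOrder V, orderLsimWidth G π

/-! ### CNFs -/

/-- A literal: `(x, true)` is the positive literal `x`, `(x, false)` is the negative literal `¬x`. -/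
abbrev Literal (X : Type*) := X × Bool

/-- A clause is a finite set of literals (their disjunction). -/
abbrev Clause (X : Type*) := Finset (Literal X)

/-- A CNF is a finite set of clauses (their conjunction). -/
abbrev CNF (X : Type*) := Finset (Clause X)

/-- The set of variables occurring in a CNF. -/
def CNF.vars {X : Type*} [DecidableEq X] (φ : CNF X) : Finset X :=
  φ.biUnion fun C => C.image Prod.fst

/-- The assignment `b` satisfies `φ`: every clause contains a literal made true by `b`. -/
def CNF.Sat {X : Type*} (φ : CNF X) (b : X → Bool) : Prop :=
  ∀ C ∈ φ, ∃ l ∈ C, b l.1 = l.2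

/-- The incidence graph of a CNF: its vertices are the variables and the clauses, and a variable is
adjacent to exactly those clauses in which it occurs (positively or negatively). -/
def CNF.incidenceGraph {X : Type*} [DecidableEq X] (φ : CNF X) :
    SimpleGraph (↥(CNF.vars φ) ⊕ ↥φ) where
  Adj
    | Sum.inl x, Sum.inr C => ∃ s : Bool, (x.1, s) ∈ C.1
    | Sum.inr C, Sum.inl x => ∃ s : Bool, (x.1, s) ∈ C.1
    | _, _ => False
  symm := ⟨by
    rintro (x | C) (y | D) h
    · exact h
    · exact h
    · exact h
    · exact h⟩
  loopless := ⟨by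
    rintro (x | C) h
    · exact h
    · exact h⟩

/-- The incidence treewidth of a CNF. -/
noncomputable def CNF.incidenceTreewidth {X : Type*} [DecidableEq X] (φ : CNF X) : ℕ :=
  treewidth (CNF.incidenceGraph φ)

/-! ### FBDDs and OBDDs with decomposable conjunction nodes -/

/-- What a node of a decision diagram over the variables `X` can be: a sink labelled by a truth
value, a conjunction node with two children, or a decision node labelled by a variable, with its
`0`-child and its `1`-child. -/
inductive NodeKind (X N : Type*) where
  | sink (value : Bool)
  | conj (left right : N)
  | decision (x : X) (zero one : N)

/-- `kind.HasChild v`: `v` is one of the children listed in `kind`. -/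
def NodeKind.HasChild {X N : Type*} : NodeKind X N → N → Prop
  | .sink _, _ => False
  | .conj u₀ u₁, v => v = u₀ ∨ v = u₁
  | .decision _ u₀ u₁, v => v = u₀ ∨ v = u₁

/-- `v` can be reached from `u` by a directed path of length at least `0`, in the directed graph
described by `kind`. -/
def NodeKind.Reach {X N : Type*} (kind : N → NodeKind X N) : N → N → Prop :=
  Relation.ReflTransGen fun u v => (kind u).HasChild v

/-- `v` can be reached from `u` by a directed path of length at least `1`. -/
def NodeKind.ProperReach {X N : Type*} (kind : N → NodeKind X N) : N → N → Prop :=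
  Relation.TransGen fun u v => (kind u).HasChild v

/-- The variables labelling the decision nodes reachable from `u` (including `u` itself). -/
def NodeKind.varsFrom {X N : Type*} (kind : N → NodeKind X N) (u : N) : Set X :=
  {x | ∃ v u₀ u₁, NodeKind.Reach kind u v ∧ kind v = .decision x u₀ u₁}

/-- An FBDD with decomposable conjunction nodes: a finite directed acyclic graph with a single
source, with at most one sink for each truth value (a constant diagram is a single sink), whose
other nodes are conjunction nodes or decision nodes with two outgoing edges each. It is
decomposable (the two children of a conjunction node share no variable) and read-once (no directed
path joins two decision nodes with the same variable). The two outgoing edges of a node may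
lead to the same child. -/
structure ConjFBDD (X : Type*) where
  Node : Type
  finite_node : Finite Node
  kind : Node → NodeKind X Node
  acyclic : ∀ u, ¬ NodeKind.ProperReach kind u u
  source : Node
  source_iff : ∀ v, v = source ↔ ∀ u, ¬ (kind u).HasChild v
  sink_unique : ∀ (s : Bool) u v, kind u = .sink s → kind v = .sink s → u = v
  decomposable : ∀ u u₀ u₁, kind u = .conj u₀ u₁ →
    Disjoint (NodeKind.varsFrom kind u₀) (NodeKind.varsFrom kind u₁)
  readOnce : ∀ u v x u₀ u₁ v₀ v₁, kind u = .decision x u₀ u₁ → kind v = .decision x v₀ v₁ →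
    ¬ NodeKind.ProperReach kind u v

namespace ConjFBDD

variable {X : Type*}

/-- The size of a diagram is its number of nodes. -/
noncomputable def size (B : ConjFBDD X) : ℕ := Nat.card B.Node

/-- The set of variables labelling the decision nodes of the diagram. -/
def vars (B : ConjFBDD X) : Set X := {x | ∃ v u₀ u₁, B.kind v = .decision x u₀ u₁}

/-- `B.Accepts u a`: the partial assignment `a`, given as the set of its pairs (variable, value), is
accepted by the subdiagram rooted at `u`. The `1`-sink accepts exactly the empty assignment, the
`0`-sink accepts nothing; a decision node for `x` accepts `a ∪ {(x, i)}` for `a` accepted by its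
`i`-child; a conjunction node accepts the unions of assignments accepted by its two children. -/
inductive Accepts (B : ConjFBDD X) : B.Node → Set (X × Bool) → Prop
  | sink {u} (h : B.kind u = .sink true) : Accepts B u ∅
  | zero {u x u₀ u₁ a} (h : B.kind u = .decision x u₀ u₁) (h₀ : Accepts B u₀ a) :
      Accepts B u (a ∪ {(x, false)})
  | one {u x u₀ u₁ a} (h : B.kind u = .decision x u₀ u₁) (h₁ : Accepts B u₁ a) :
      Accepts B u (a ∪ {(x, true)})
  | conj {u u₀ u₁ a₀ a₁} (h : B.kind u = .conj u₀ u₁) (h₀ : Accepts B u₀ a₀)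
      (h₁ : Accepts B u₁ a₁) : Accepts B u (a₀ ∪ a₁)

/-- The assignment `b` satisfies `B`: it extends a partial assignment accepted by the source. (Only
the values of `b` on `B.vars` matter.) -/
def Sat (B : ConjFBDD X) (b : X → Bool) : Prop :=
  ∃ a, B.Accepts B.source a ∧ ∀ p ∈ a, b p.1 = p.2

/-- `B` represents `φ`: they have the same set of variables and the same satisfying assignments. -/
def Represents [DecidableEq X] (B : ConjFBDD X) (φ : CNF X) : Prop :=
  B.vars = (CNF.vars φ : Set X) ∧ ∀ b : X → Bool, B.Sat b ↔ CNF.Sat φ b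

/-- `B` obeys the linear order `π` of the variables: along every directed path the labels of the
decision nodes increase. -/
def Obeys (B : ConjFBDD X) (π : LinearOrder X) : Prop :=
  ∀ u v x y u₀ u₁ v₀ v₁, B.kind u = .decision x u₀ u₁ → B.kind v = .decision y v₀ v₁ →
    NodeKind.ProperReach B.kind u v → π.lt x y

/-- An OBDD with decomposable conjunction nodes: a diagram that obeys some linear order. (A linear
order on a set of variables containing `B.vars` extends to all of `X`.) -/
def IsConjOBDD (B : ConjFBDD X) : Prop := ∃ π : LinearOrder X, B.Obeys π

end ConjFBDD

/-! ### The formulas built from graphs -/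

/-- No vertex of `G` is isolated. -/
def NoIsolated {V : Type*} (G : SimpleGraph V) : Prop := ∀ v, ∃ w, G.Adj v w

/-- The graph `G*` on two disjoint copies of the vertex set: for each edge `{u, v}` of `G` it has the
edges joining the first copy of `u` to the second copy of `v`, and the first copy of `v` to the
second copy of `u`. Vertex `(v, i)` is the copy of `v` with index `i`. -/
def starGraph {V : Type*} (G : SimpleGraph V) : SimpleGraph (V × Fin 2) where
  Adj p q := G.Adj p.1 q.1 ∧ p.2 ≠ q.2
  symm := ⟨fun _ _ h => ⟨h.1.symm, h.2.symm⟩⟩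
  loopless := ⟨fun _ h => h.2 rfl⟩

open Classical in
/-- The CNF whose clauses are `u ∨ v` for the edges `{u, v}` of `G`. -/
noncomputable def edgeCNF {V : Type*} [Fintype V] [DecidableEq V] (G : SimpleGraph V) : CNF V :=
  (Finset.univ.filter fun p : V × V => G.Adj p.1 p.2).image fun p => {(p.1, true), (p.2, true)}

/-- The clause consisting of the negative literals of all variables of the copy with index `i`. -/
def negCopyClause (V : Type*) [Fintype V] [DecidableEq V] (i : Fin 2) : Clause (V × Fin 2) :=
  Finset.univ.image fun v : V => ((v, i), false)

/-- The CNF `ψ(G)`: the edge clauses of `G*` together with the two long negative clauses. -/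
noncomputable def psi {V : Type*} [Fintype V] [DecidableEq V] (G : SimpleGraph V) :
    CNF (V × Fin 2) :=
  edgeCNF (starGraph G) ∪ {negCopyClause V 0, negCopyClause V 1}

/-! ### Decision diagrams following a partial assignment -/

namespace ConjFBDD

variable {X : Type*}

/-! The graph is the product of a complete ternary tree of height `2 * p + h` with a path on `p`
vertices, where `p` is fixed and `h` grows. Bags made of the column over a tree node and the column
over its parent give treewidth O(p). The incidence graph has width O(p) too: each edge clause is
placed near its column, and the two long clauses join every bag. Since log n = O(h), both lower
bounds ask for induced matchings of size Ω(h p) across a prefix.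

Such matchings come from induction on the height (`exists_initialSegment_crossingMatching`). Each of
the three subtrees below the root has its own good threshold. At the middle one, the subtree it
belongs to contributes its matching, while the other two leave many vertices on both sides, which
forces `p` further disjoint crossing edges outside that subtree. Degrees are at most 6, so a
constant fraction of the matching is induced.

For diagrams, a 2-coloring embeds the graph as an induced subgraph of its star graph, so some prefix
of the variable order is crossed by an induced matching u_i w_i, i ≤ m, with all u_i in the prefix
and in one copy. For a proper nonempty set J of indices, make exactly the u_i with i in J false.
Only the long clause of the other copy fails, and making any single w_i with i outside J false
repairs it. A conjunction node on the way cannot separate these w_i: each child would be satisfied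
thanks to a repair made elsewhere. So the diagram has a node with all of them and nothing of the
prefix below it (`ConjFBDD.exists_follows`). Different J reach different nodes, for otherwise a
repair of J' through w_j, with j in J but not in J', could be transplanted below the prefix of J,
violating u_j ∨ w_j. Hence there are at least 2^m - 2 nodes (`two_pow_le_size_of_represents`). -/

/-- The total assignment `b` extends a partial assignment accepted by the node `u`. -/
def NodeSat (B : ConjFBDD X) (u : B.Node) (b : X → Bool) : Prop :=
  ∃ a, B.Accepts u a ∧ ∀ p ∈ a, b p.1 = p.2

theorem varsFrom_subset_of_hasChild (B : ConjFBDD X) {u v : B.Node} (h : (B.kind u).HasChild v) :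
    NodeKind.varsFrom B.kind v ⊆ NodeKind.varsFrom B.kind u := by
  rintro x ⟨w, w₀, w₁, hw, hk⟩
  exact ⟨w, w₀, w₁, Relation.ReflTransGen.head h hw, hk⟩

theorem mem_varsFrom_self (B : ConjFBDD X) {u u₀ u₁ : B.Node} {x : X}
    (h : B.kind u = .decision x u₀ u₁) : x ∈ NodeKind.varsFrom B.kind u :=
  ⟨u, u₀, u₁, Relation.ReflTransGen.refl, h⟩

theorem hasChild_zero (B : ConjFBDD X) {u u₀ u₁ : B.Node} {x : X}
    (h : B.kind u = .decision x u₀ u₁) : (B.kind u).HasChild u₀ := by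
  rw [h]; exact Or.inl rfl

theorem hasChild_one (B : ConjFBDD X) {u u₀ u₁ : B.Node} {x : X}
    (h : B.kind u = .decision x u₀ u₁) : (B.kind u).HasChild u₁ := by
  rw [h]; exact Or.inr rfl

theorem hasChild_left (B : ConjFBDD X) {u u₀ u₁ : B.Node}
    (h : B.kind u = .conj u₀ u₁) : (B.kind u).HasChild u₀ := by
  rw [h]; exact Or.inl rfl

theorem hasChild_right (B : ConjFBDD X) {u u₀ u₁ : B.Node}
    (h : B.kind u = .conj u₀ u₁) : (B.kind u).HasChild u₁ := by
  rw [h]; exact Or.inr rfl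

theorem Accepts.fst_mem_varsFrom {B : ConjFBDD X} {u : B.Node} {a : Set (X × Bool)}
    (h : B.Accepts u a) : ∀ p ∈ a, p.1 ∈ NodeKind.varsFrom B.kind u := by
  induction h with
  | sink h => simp
  | zero h _ ih =>
    rintro p (hp | rfl)
    · exact B.varsFrom_subset_of_hasChild (B.hasChild_zero h) (ih p hp)
    · exact B.mem_varsFrom_self h
  | one h _ ih =>
    rintro p (hp | rfl)
    · exact B.varsFrom_subset_of_hasChild (B.hasChild_one h) (ih p hp)
    · exact B.mem_varsFrom_self h
  | conj h _ _ ih₀ ih₁ =>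
    rintro p (hp | hp)
    · exact B.varsFrom_subset_of_hasChild (B.hasChild_left h) (ih₀ p hp)
    · exact B.varsFrom_subset_of_hasChild (B.hasChild_right h) (ih₁ p hp)

theorem NodeSat.congr {B : ConjFBDD X} {u : B.Node} {b b' : X → Bool} (h : B.NodeSat u b)
    (hb : ∀ x ∈ NodeKind.varsFrom B.kind u, b' x = b x) : B.NodeSat u b' := by
  obtain ⟨a, ha, hab⟩ := h
  exact ⟨a, ha, fun p hp => (hb _ (ha.fst_mem_varsFrom p hp)).trans (hab p hp)⟩

theorem nodeSat_decision (B : ConjFBDD X) {u u₀ u₁ : B.Node} {x : X}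
    (h : B.kind u = .decision x u₀ u₁) (b : X → Bool) :
    B.NodeSat u b ↔ B.NodeSat (bif b x then u₁ else u₀) b := by
  constructor
  · rintro ⟨a, ha, hab⟩
    cases ha with
    | sink h' => simp [h] at h'
    | conj h' => simp [h] at h'
    | zero h' h₀ =>
      rw [h] at h'
      obtain ⟨rfl, rfl, rfl⟩ : _ ∧ _ ∧ _ := by simpa using h'
      have : b x = false := hab (x, false) (by simp)
      rw [this]
      exact ⟨_, h₀, fun p hp => hab p (Or.inl hp)⟩
    | one h' h₁ =>
      rw [h] at h'
      obtain ⟨rfl, rfl, rfl⟩ : _ ∧ _ ∧ _ := by simpa using h'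
      have : b x = true := hab (x, true) (by simp)
      rw [this]
      exact ⟨_, h₁, fun p hp => hab p (Or.inl hp)⟩
  · rintro ⟨a, ha, hab⟩
    cases hx : b x with
    | false =>
      rw [hx] at ha
      refine ⟨_, Accepts.zero h ha, ?_⟩
      rintro p (hp | rfl)
      · exact hab p hp
      · exact hx
    | true =>
      rw [hx] at ha
      refine ⟨_, Accepts.one h ha, ?_⟩
      rintro p (hp | rfl)
      · exact hab p hp
      · exact hx

theorem nodeSat_conj (B : ConjFBDD X) {u u₀ u₁ : B.Node} (h : B.kind u = .conj u₀ u₁)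
    (b : X → Bool) : B.NodeSat u b ↔ B.NodeSat u₀ b ∧ B.NodeSat u₁ b := by
  constructor
  · rintro ⟨a, ha, hab⟩
    cases ha with
    | sink h' => simp [h] at h'
    | zero h' => simp [h] at h'
    | one h' => simp [h] at h'
    | conj h' h₀ h₁ =>
      rw [h] at h'
      obtain ⟨rfl, rfl⟩ : _ ∧ _ := by simpa using h'
      exact ⟨⟨_, h₀, fun p hp => hab p (Or.inl hp)⟩, ⟨_, h₁, fun p hp => hab p (Or.inr hp)⟩⟩
  · rintro ⟨⟨a₀, h₀, hab₀⟩, ⟨a₁, h₁, hab₁⟩⟩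
    refine ⟨_, Accepts.conj h h₀ h₁, ?_⟩
    rintro p (hp | hp)
    · exact hab₀ p hp
    · exact hab₁ p hp

/-- `B.Follows b S u`: some path from the source to `u` queries only variables of `S` and, at each of
its decision nodes, takes the edge selected by `b`. -/
inductive Follows (B : ConjFBDD X) (b : X → Bool) (S : Set X) : B.Node → Prop
  | source : Follows B b S B.source
  | decision {u x u₀ u₁} (hu : Follows B b S u) (h : B.kind u = .decision x u₀ u₁) (hx : x ∈ S) :
      Follows B b S (bif b x then u₁ else u₀)
  | left {u u₀ u₁} (hu : Follows B b S u) (h : B.kind u = .conj u₀ u₁) : Follows B b S u₀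
  | right {u u₀ u₁} (hu : Follows B b S u) (h : B.kind u = .conj u₀ u₁) : Follows B b S u₁

/-- Satisfaction passes from a conjunction node to both children and from a decision node to the
selected child, and agreement on `S` makes `c` select the same edges as `b`. -/
theorem Follows.nodeSat {B : ConjFBDD X} {b c : X → Bool} {S : Set X} {u : B.Node}
    (h : B.Follows b S u) (hc : ∀ x ∈ S, c x = b x) (hs : B.Sat c) : B.NodeSat u c := by
  induction h with
  | source => exact hs
  | decision _ h hx ih =>
    rw [← hc _ hx]
    exact (B.nodeSat_decision h c).1 ih
  | left _ h ih => exact ((B.nodeSat_conj h c).1 ih).1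
  | right _ h ih => exact ((B.nodeSat_conj h c).1 ih).2

theorem hasChild_bif (B : ConjFBDD X) {u u₀ u₁ : B.Node} {x : X}
    (h : B.kind u = .decision x u₀ u₁) (t : Bool) :
    (B.kind u).HasChild (bif t then u₁ else u₀) := by
  cases t
  · exact B.hasChild_zero h
  · exact B.hasChild_one h

theorem notMem_varsFrom_child (B : ConjFBDD X) {u v u₀ u₁ : B.Node} {x : X}
    (h : B.kind u = .decision x u₀ u₁) (hv : (B.kind u).HasChild v) :
    x ∉ NodeKind.varsFrom B.kind v := by
  rintro ⟨w, w₀, w₁, hw, hk⟩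
  exact B.readOnce u w x _ _ _ _ h hk (Relation.TransGen.head' hv hw)

/-- The values of the variables below a node reached by a satisfying assignment may be replaced by
values accepted by this node. -/
theorem Follows.sat_of_nodeSat {B : ConjFBDD X} {b c : X → Bool} {S : Set X} {u : B.Node}
    (h : B.Follows b S u) (hc : ∀ x ∈ S, c x = b x) (hs : B.Sat c) (d : X → Bool)
    (hd : ∀ x, x ∉ NodeKind.varsFrom B.kind u → d x = c x) (hu : B.NodeSat u d) : B.Sat d := by
  induction h with
  | source => exact hu
  | @decision u x u₀ u₁ hf h hx ih =>
    have hch := B.hasChild_bif h (b x)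
    have hdx : d x = b x := (hd x (B.notMem_varsFrom_child h hch)).trans (hc x hx)
    refine ih (fun y hy => hd y fun hy' => hy (B.varsFrom_subset_of_hasChild hch hy')) ?_
    rw [B.nodeSat_decision h, hdx]
    exact hu
  | left hf h ih =>
    have hch := B.hasChild_left h
    refine ih (fun y hy => hd y fun hy' => hy (B.varsFrom_subset_of_hasChild hch hy')) ?_
    -- The sibling is satisfied by `c`, and by decomposability `d` differs from `c` only on
    -- variables that do not occur below the sibling.
    refine (B.nodeSat_conj h d).2 ⟨hu, ?_⟩
    refine ((hf.right h).nodeSat hc hs).congr fun x hx => hd x fun hx' => ?_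
    exact Set.disjoint_left.1 (B.decomposable _ _ _ h) hx' hx
  | right hf h ih =>
    have hch := B.hasChild_right h
    refine ih (fun y hy => hd y fun hy' => hy (B.varsFrom_subset_of_hasChild hch hy')) ?_
    refine (B.nodeSat_conj h d).2 ⟨?_, hu⟩
    refine ((hf.left h).nodeSat hc hs).congr fun x hx => hd x fun hx' => ?_
    exact Set.disjoint_left.1 (B.decomposable _ _ _ h) hx hx'

/-- Descendants count as smaller, so a minimal node of a set is a deepest one. -/
theorem wellFounded_properReach (B : ConjFBDD X) :
    WellFounded fun u v => NodeKind.ProperReach B.kind v u := by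
  have := B.finite_node
  have : IsTrans B.Node fun u v => NodeKind.ProperReach B.kind v u :=
    ⟨fun _ _ _ h h' => Relation.TransGen.trans h' h⟩
  have : Std.Irrefl fun u v => NodeKind.ProperReach B.kind v u := ⟨B.acyclic⟩
  exact Finite.wellFounded_of_trans_of_irrefl _

theorem wellFounded_properReach_swap (B : ConjFBDD X) :
    WellFounded fun u v => NodeKind.ProperReach B.kind u v := by
  have := B.finite_node
  have : IsTrans B.Node fun u v => NodeKind.ProperReach B.kind u v :=
    ⟨fun _ _ _ h h' => Relation.TransGen.trans h h'⟩
  have : Std.Irrefl fun u v => NodeKind.ProperReach B.kind u v := ⟨B.acyclic⟩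
  exact Finite.wellFounded_of_trans_of_irrefl _

theorem reach_source (B : ConjFBDD X) (v : B.Node) : NodeKind.Reach B.kind B.source v := by
  induction v using B.wellFounded_properReach_swap.induction with
  | _ v ih =>
    by_cases hv : v = B.source
    · rw [hv]
      exact Relation.ReflTransGen.refl
    · have h := mt (B.source_iff v).2 hv
      push Not at h
      obtain ⟨u, hu⟩ := h
      exact (ih u (Relation.TransGen.single hu)).tail hu

theorem vars_subset_varsFrom_source (B : ConjFBDD X) :
    B.vars ⊆ NodeKind.varsFrom B.kind B.source := by
  rintro x ⟨v, v₀, v₁, h⟩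
  exact ⟨v, v₀, v₁, B.reach_source v, h⟩

/-- If `b` falsifies the diagram but changing the value of any one variable of `W` from true to false
makes it satisfied, then no conjunction node met by `b` separates the variables of `W`, and some node
reached by querying `S` alone has all of `W` and nothing of `S` below it. -/
theorem exists_follows (B : ConjFBDD X) [DecidableEq X] {π : LinearOrder X} (hπ : B.Obeys π)
    {S W : Set X} (hS : ∀ u ∈ S, ∀ v, π.le v u → v ∈ S) (hWS : W ⊆ B.vars) {b : X → Bool}
    (hb : ¬ B.Sat b) (hW : ∀ w ∈ W, w ∉ S ∧ B.Sat (Function.update b w false)) :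
    ∃ u, B.Follows b S u ∧ W ⊆ NodeKind.varsFrom B.kind u ∧
      ∀ x ∈ NodeKind.varsFrom B.kind u, x ∉ S := by
  have hagree : ∀ w ∈ W, ∀ x ∈ S, Function.update b w false x = b x := fun w hw x hx =>
    Function.update_of_ne (fun h => (hW w hw).1 (by rwa [h] at hx)) _ _
  -- A deepest followed node with all of `W` below it. If a variable of `S` still occurred below it,
  -- one could descend further or the diagram would accept `b`.
  obtain ⟨u, ⟨hu, hWu⟩, hmin⟩ := B.wellFounded_properReach.has_min
    {u | B.Follows b S u ∧ W ⊆ NodeKind.varsFrom B.kind u}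
    ⟨B.source, Follows.source, hWS.trans B.vars_subset_varsFrom_source⟩
  -- A node that does not see `w` cannot tell `b` from its repair at `w`.
  have hcong : ∀ w ∈ W, ∀ v, B.Follows b S v → w ∉ NodeKind.varsFrom B.kind v →
      B.NodeSat v b := fun w hw v hv hwv =>
    (hv.nodeSat (hagree w hw) (hW w hw).2).congr fun x hx =>
      (Function.update_of_ne (fun h => hwv (by rwa [h] at hx)) _ _).symm
  have hsat : ∀ w ∈ W, ¬ B.NodeSat u b := fun w hw h =>
    hb (hu.sat_of_nodeSat (hagree w hw) (hW w hw).2 b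
      (fun x hx => (Function.update_of_ne (fun h => hx (by rw [h]; exact hWu hw)) _ _).symm) h)
  refine ⟨u, hu, hWu, ?_⟩
  rintro y ⟨v, v₀, v₁, hv, hk⟩ hyS
  cases hku : B.kind u with
  | sink s =>
    rcases Relation.ReflTransGen.cases_head hv with rfl | ⟨w, hw, -⟩
    · rw [hku] at hk; cases hk
    · rw [hku] at hw; exact hw
  | decision x u₀ u₁ =>
    have hxS : x ∈ S := by
      rcases Relation.reflTransGen_iff_eq_or_transGen.1 hv with rfl | hv
      · rw [hku] at hk
        cases hk
        exact hyS
      -- The label `x` precedes `y` in the order, and `S` is a prefix.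
      · exact hS y hyS x (@le_of_lt X π.toPreorder _ _ (hπ u v x y _ _ _ _ hku hk hv))
    have hf := hu.decision hku hxS
    refine hmin _ ⟨hf, fun w hw => ?_⟩ (Relation.TransGen.single (B.hasChild_bif hku (b x)))
    by_contra hwv
    exact hsat w hw ((B.nodeSat_decision hku b).2 (hcong w hw _ hf hwv))
  | conj u₀ u₁ =>
    have h₀ : ¬ W ⊆ NodeKind.varsFrom B.kind u₀ := fun h =>
      hmin _ ⟨hu.left hku, h⟩ (Relation.TransGen.single (B.hasChild_left hku))
    have h₁ : ¬ W ⊆ NodeKind.varsFrom B.kind u₁ := fun h =>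
      hmin _ ⟨hu.right hku, h⟩ (Relation.TransGen.single (B.hasChild_right hku))
    obtain ⟨w₀, hw₀, hn₀⟩ := Set.not_subset.1 h₀
    obtain ⟨w₁, hw₁, hn₁⟩ := Set.not_subset.1 h₁
    -- Each child misses some repairing variable and so accepts `b` itself; then `u` accepts `b`,
    -- which is impossible.
    exact hsat w₀ hw₀ ((B.nodeSat_conj hku b).2
      ⟨hcong w₀ hw₀ _ (hu.left hku) hn₀, hcong w₁ hw₁ _ (hu.right hku) hn₁⟩)

end ConjFBDD

/-! ### Diagrams for the formulas built from graphs -/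

section Psi

variable {V : Type*} [Fintype V] [DecidableEq V] (G : SimpleGraph V)

theorem psi_sat_iff (b : V × Fin 2 → Bool) :
    CNF.Sat (psi G) b ↔ (∀ x y, (starGraph G).Adj x y → b x = true ∨ b y = true) ∧
      ∀ i : Fin 2, ∃ v, b (v, i) = false := by
  constructor
  · intro h
    refine ⟨fun x y hxy => ?_, fun i => ?_⟩
    · obtain ⟨l, hl, hb⟩ := h {(x, true), (y, true)} (by
        simp only [psi, edgeCNF, Finset.mem_union, Finset.mem_image, Finset.mem_filter]
        exact Or.inl ⟨(x, y), ⟨Finset.mem_univ _, hxy⟩, rfl⟩)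
      simp only [Finset.mem_insert, Finset.mem_singleton] at hl
      rcases hl with rfl | rfl
      · exact Or.inl hb
      · exact Or.inr hb
    · obtain ⟨l, hl, hb⟩ := h (negCopyClause V i) (by
        simp only [psi, Finset.mem_union, Finset.mem_insert, Finset.mem_singleton]
        fin_cases i
        · exact Or.inr (Or.inl rfl)
        · exact Or.inr (Or.inr rfl))
      simp only [negCopyClause, Finset.mem_image] at hl
      obtain ⟨v, -, rfl⟩ := hl
      exact ⟨v, hb⟩
  · rintro ⟨h₁, h₂⟩ C hC
    simp only [psi, edgeCNF, Finset.mem_union, Finset.mem_image, Finset.mem_filter,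
      Finset.mem_insert, Finset.mem_singleton] at hC
    have hneg : ∀ i, ∃ l ∈ negCopyClause V i, b l.1 = l.2 := fun i => by
      obtain ⟨v, hv⟩ := h₂ i
      exact ⟨((v, i), false), Finset.mem_image_of_mem _ (Finset.mem_univ v), hv⟩
    rcases hC with ⟨⟨x, y⟩, ⟨-, hxy⟩, rfl⟩ | rfl | rfl
    · rcases h₁ x y hxy with h | h
      · exact ⟨(x, true), by simp, h⟩
      · exact ⟨(y, true), by simp, h⟩
    · exact hneg 0
    · exact hneg 1

theorem psi_vars : CNF.vars (psi G) = Finset.univ := by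
  refine Finset.eq_univ_of_forall fun x => ?_
  simp only [CNF.vars, Finset.mem_biUnion, Finset.mem_image]
  refine ⟨negCopyClause V x.2, ?_, ((x.1, x.2), false), ?_, rfl⟩
  · simp only [psi, Finset.mem_union, Finset.mem_insert, Finset.mem_singleton]
    have : x.2 = 0 ∨ x.2 = 1 := by omega
    rcases this with h | h <;> simp [h]
  · exact Finset.mem_image_of_mem _ (Finset.mem_univ _)

/-- The assignment giving false to the first ends of the edges in `J` and true to everything else. -/
def firstEndsFalse {X : Type*} [DecidableEq X] (J : Finset (X × X)) (x : X) : Bool :=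
  decide (x ∉ J.image Prod.fst)

theorem firstEndsFalse_eq_false {X : Type*} [DecidableEq X] {J : Finset (X × X)} {x : X} :
    firstEndsFalse J x = false ↔ ∃ p ∈ J, p.1 = x := by
  simp only [firstEndsFalse, decide_eq_false_iff_not, not_not, Finset.mem_image]

/-- A fooling set argument: the nonempty proper subsets `J` of the matching are mapped injectively
to nodes, which accounts for the 2 on the right. Inducedness is needed only between first and second
ends, as all first ends lie in copy `a`. -/
theorem two_pow_le_size_of_represents {B : ConjFBDD (V × Fin 2)} {π : LinearOrder (V × Fin 2)}
    (hπ : B.Obeys π) (hB : B.Represents (psi G)) {S : Set (V × Fin 2)}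
    (hS : ∀ u ∈ S, ∀ v, π.le v u → v ∈ S) (P : Finset ((V × Fin 2) × (V × Fin 2))) (a : Fin 2)
    (hP : ∀ p ∈ P, (starGraph G).Adj p.1 p.2 ∧ p.1 ∈ S ∧ p.2 ∉ S ∧ p.1.2 = a)
    (hind : ∀ p ∈ P, ∀ q ∈ P, p ≠ q → ¬ (starGraph G).Adj p.1 q.2) :
    2 ^ P.card ≤ B.size + 2 := by
  classical
  have hsat : ∀ b, B.Sat b ↔ _ := fun b => (hB.2 b).trans (psi_sat_iff G b)
  have hcopy : ∀ p ∈ P, p.2.2 ≠ a := fun p hp h => (hP p hp).1.2 ((hP p hp).2.2.2.trans h.symm)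
  have hunsat : ∀ J ⊆ P, ¬ B.Sat (firstEndsFalse J) := by
    intro J hJ h
    obtain ⟨i, hi⟩ := exists_ne a
    -- Copy `i`, the other one, contains no false variable, so its long negative clause fails.
    obtain ⟨v, hv⟩ := ((hsat _).1 h).2 i
    obtain ⟨p, hp, hpv⟩ := firstEndsFalse_eq_false.1 hv
    have := (hP p (hJ hp)).2.2.2
    rw [hpv] at this
    exact hi this
  have hupd : ∀ J ⊆ P, J.Nonempty → ∀ q ∈ P, q ∉ J →
      B.Sat (Function.update (firstEndsFalse J) q.2 false) := by
    intro J hJ hne q hq hqJ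
    have hfalse : ∀ x, Function.update (firstEndsFalse J) q.2 false x = false ↔
        x = q.2 ∨ ∃ p ∈ J, p.1 = x := by
      intro x
      by_cases hx : x = q.2
      · simp [hx]
      · rw [Function.update_of_ne hx, firstEndsFalse_eq_false]
        simp [hx]
    rw [hsat]
    refine ⟨fun x y hxy => ?_, fun i => ?_⟩
    · by_contra hcon
      push Not at hcon
      simp only [ne_eq, Bool.not_eq_true, hfalse] at hcon
      obtain ⟨hx, hy⟩ := hcon
      rcases hx with rfl | ⟨p, hp, rfl⟩ <;> rcases hy with rfl | ⟨p', hp', rfl⟩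
      · exact hxy.ne rfl
      · exact hind p' (hJ hp') q hq (fun h => hqJ (h ▸ hp')) hxy.symm
      · exact hind p (hJ hp) q hq (fun h => hqJ (h ▸ hp)) hxy
      · exact hxy.2 ((hP p (hJ hp)).2.2.2.trans (hP p' (hJ hp')).2.2.2.symm)
    · by_cases hi : i = a
      · obtain ⟨p, hp⟩ := hne
        refine ⟨p.1.1, (hfalse _).2 (Or.inr ⟨p, hp, ?_⟩)⟩
        rw [hi, ← (hP p (hJ hp)).2.2.2]
      · refine ⟨q.2.1, (hfalse _).2 (Or.inl ?_)⟩
        have := hcopy q hq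
        have : i = q.2.2 := by omega
        rw [this]
  -- The empty set is dropped because the repaired assignment needs a false variable in copy `a`,
  -- and `P` because some second end must remain available for a repair.
  set 𝒥 : Finset (Finset ((V × Fin 2) × (V × Fin 2))) := (P.powerset.erase ∅).erase P with h𝒥
  have hmem : ∀ J ∈ 𝒥, J ⊆ P ∧ J.Nonempty ∧ ∃ q ∈ P, q ∉ J := by
    intro J hJ
    simp only [h𝒥, Finset.mem_erase, Finset.mem_powerset] at hJ
    refine ⟨hJ.2.2, Finset.nonempty_iff_ne_empty.2 hJ.2.1, ?_⟩
    by_contra! h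
    exact hJ.1 (Finset.Subset.antisymm hJ.2.2 h)
  have hnode : ∀ J ∈ 𝒥, ∃ u, B.Follows (firstEndsFalse J) S u ∧
      (∀ q ∈ P, q ∉ J → q.2 ∈ NodeKind.varsFrom B.kind u) ∧
      ∀ x ∈ NodeKind.varsFrom B.kind u, x ∉ S := by
    intro J hJ
    obtain ⟨hJP, hne, -⟩ := hmem J hJ
    obtain ⟨u, hu, hW, huS⟩ := B.exists_follows hπ (S := S)
      (W := {x | ∃ q ∈ P, q ∉ J ∧ q.2 = x}) hS
      (fun x _ => by rw [hB.1, psi_vars]; exact Finset.mem_coe.2 (Finset.mem_univ x))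
      (hunsat J hJP) (by
        rintro _ ⟨q, hq, hqJ, rfl⟩
        exact ⟨(hP q hq).2.2.1, hupd J hJP hne q hq hqJ⟩)
    exact ⟨u, hu, fun q hq hqJ => hW ⟨q, hq, hqJ, rfl⟩, huS⟩
  have : Nonempty B.Node := ⟨B.source⟩
  choose! node hfol hW hnS using hnode
  have hsub : ∀ J ∈ 𝒥, ∀ J' ∈ 𝒥, node J = node J' → J ⊆ J' := by
    intro J hJ J' hJ' heq j hj
    by_contra hjJ'
    obtain ⟨hJP, hne, q, hq, hqJ⟩ := hmem J hJ
    obtain ⟨hJP', hne', -⟩ := hmem J' hJ'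
    have hjP := hJP hj
    have hag : ∀ (I : Finset ((V × Fin 2) × (V × Fin 2))), ∀ r ∈ P, ∀ x ∈ S,
        Function.update (firstEndsFalse I) r.2 false x = firstEndsFalse I x := fun I r hr x hx =>
      Function.update_of_ne (fun h => (hP r hr).2.2.1 (by rwa [h] at hx)) _ _
    have h' := (hfol J' hJ').nodeSat (hag J' j hjP) (hupd J' hJP' hne' j hjP hjJ')
    rw [← heq] at h'
    -- The hybrid follows `J` outside the common node and the repair of `J'` at `j.2` below it. It
    -- satisfies the diagram although both `j.1` and `j.2` are false.
    have hd := (hfol J hJ).sat_of_nodeSat (hag J q hq) (hupd J hJP hne q hq hqJ)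
      (fun x => if x ∈ NodeKind.varsFrom B.kind (node J) then
        Function.update (firstEndsFalse J') j.2 false x
        else Function.update (firstEndsFalse J) q.2 false x)
      (fun x hx => if_neg hx) (h'.congr fun x hx => if_pos hx)
    have hj2 : j.2 ∈ NodeKind.varsFrom B.kind (node J) := by
      rw [heq]; exact hW J' hJ' j hjP hjJ'
    have hj1 : j.1 ∉ NodeKind.varsFrom B.kind (node J) := fun h => hnS J hJ _ h (hP j hjP).2.1
    have := ((hsat _).1 hd).1 j.1 j.2 (hP j hjP).1
    rw [if_neg hj1, if_pos hj2, Function.update_self, hag J q hq _ (hP j hjP).2.1,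
      firstEndsFalse_eq_false.2 ⟨j, hj, rfl⟩] at this
    simp at this
  have := B.finite_node
  have := Fintype.ofFinite B.Node
  have hcard : 𝒥.card ≤ B.size := by
    rw [ConjFBDD.size, Nat.card_eq_fintype_card]
    exact Finset.card_le_card_of_injOn node (fun _ _ => Finset.mem_univ _) fun J hJ J' hJ' h =>
      Finset.Subset.antisymm (hsub J hJ J' hJ' h) (hsub J' hJ' J hJ h.symm)
  have h1 := Finset.pred_card_le_card_erase (s := P.powerset.erase ∅) (a := P)
  have h2 := Finset.pred_card_le_card_erase (s := P.powerset) (a := ∅)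
  rw [Finset.card_powerset] at h2
  rw [← h𝒥] at h1
  omega

end Psi

/-! ### Crossing matchings in products of trees and paths -/

/-- `P` is a matching of `G`, given as a set of ordered pairs, each of which leads from `S` to its
complement. -/
structure IsCrossingMatching {V : Type*} (G : SimpleGraph V) (S : Set V) (P : Finset (V × V)) :
    Prop where
  adj : ∀ q ∈ P, G.Adj q.1 q.2
  fst_mem : ∀ q ∈ P, q.1 ∈ S
  snd_notMem : ∀ q ∈ P, q.2 ∉ S
  injOn_fst : Set.InjOn Prod.fst (P : Set (V × V))
  injOn_snd : Set.InjOn Prod.snd (P : Set (V × V))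

namespace IsCrossingMatching

variable {V : Type*} {G : SimpleGraph V} {S : Set V}

theorem empty : IsCrossingMatching G S ∅ := by
  constructor <;> simp

theorem mono {P Q : Finset (V × V)} (h : IsCrossingMatching G S P) (hQ : Q ⊆ P) :
    IsCrossingMatching G S Q where
  adj q hq := h.adj q (hQ hq)
  fst_mem q hq := h.fst_mem q (hQ hq)
  snd_notMem q hq := h.snd_notMem q (hQ hq)
  injOn_fst := h.injOn_fst.mono (Finset.coe_subset.2 hQ)
  injOn_snd := h.injOn_snd.mono (Finset.coe_subset.2 hQ)

theorem union [DecidableEq V] {P Q : Finset (V × V)} (hP : IsCrossingMatching G S P)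
    (hQ : IsCrossingMatching G S Q) (h₁ : ∀ p ∈ P, ∀ q ∈ Q, p.1 ≠ q.1)
    (h₂ : ∀ p ∈ P, ∀ q ∈ Q, p.2 ≠ q.2) : IsCrossingMatching G S (P ∪ Q) where
  adj q hq := (Finset.mem_union.1 hq).elim (hP.adj q) (hQ.adj q)
  fst_mem q hq := (Finset.mem_union.1 hq).elim (hP.fst_mem q) (hQ.fst_mem q)
  snd_notMem q hq := (Finset.mem_union.1 hq).elim (hP.snd_notMem q) (hQ.snd_notMem q)
  injOn_fst := by
    intro p hp q hq h
    rcases Finset.mem_union.1 hp with hp | hp <;> rcases Finset.mem_union.1 hq with hq | hq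
    · exact hP.injOn_fst hp hq h
    · exact absurd h (h₁ p hp q hq)
    · exact absurd h.symm (h₁ q hq p hp)
    · exact hQ.injOn_fst hp hq h
  injOn_snd := by
    intro p hp q hq h
    rcases Finset.mem_union.1 hp with hp | hp <;> rcases Finset.mem_union.1 hq with hq | hq
    · exact hP.injOn_snd hp hq h
    · exact absurd h (h₂ p hp q hq)
    · exact absurd h.symm (h₂ q hq p hp)
    · exact hQ.injOn_snd hp hq h

/-- The image of a crossing matching under an embedding of its vertices. -/
theorem image {V' : Type*} [DecidableEq V'] {G' : SimpleGraph V'} {S' : Set V'} {U : Set V}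
    {P : Finset (V × V)} (h : IsCrossingMatching G S P) (hU : ∀ q ∈ P, q.1 ∈ U ∧ q.2 ∈ U)
    {f : V → V'} (hf : Set.InjOn f U)
    (hadj : ∀ x ∈ U, ∀ y ∈ U, G.Adj x y → G'.Adj (f x) (f y))
    (hS : ∀ x ∈ U, f x ∈ S' ↔ x ∈ S) :
    IsCrossingMatching G' S' (P.image (Prod.map f f)) ∧
      (P.image (Prod.map f f)).card = P.card := by
  have h₁ : ∀ p ∈ P, ∀ q ∈ P, f p.1 = f q.1 → p = q := fun p hp q hq e =>
    h.injOn_fst hp hq (hf (hU p hp).1 (hU q hq).1 e)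
  have h₂ : ∀ p ∈ P, ∀ q ∈ P, f p.2 = f q.2 → p = q := fun p hp q hq e =>
    h.injOn_snd hp hq (hf (hU p hp).2 (hU q hq).2 e)
  refine ⟨⟨?_, ?_, ?_, ?_, ?_⟩, ?_⟩
  · simp only [Finset.forall_mem_image, Prod.map_fst, Prod.map_snd]
    exact fun q hq => hadj _ (hU q hq).1 _ (hU q hq).2 (h.adj q hq)
  · simp only [Finset.forall_mem_image, Prod.map_fst]
    exact fun q hq => (hS _ (hU q hq).1).2 (h.fst_mem q hq)
  · simp only [Finset.forall_mem_image, Prod.map_snd]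
    exact fun q hq hs => h.snd_notMem q hq ((hS _ (hU q hq).2).1 hs)
  · intro p hp q hq e
    obtain ⟨p', hp', rfl⟩ := Finset.mem_image.1 hp
    obtain ⟨q', hq', rfl⟩ := Finset.mem_image.1 hq
    rw [h₁ p' hp' q' hq' e]
  · intro p hp q hq e
    obtain ⟨p', hp', rfl⟩ := Finset.mem_image.1 hp
    obtain ⟨q', hq', rfl⟩ := Finset.mem_image.1 hq
    rw [h₂ p' hp' q' hq' e]
  · exact Finset.card_image_of_injOn fun p hp q hq e => h₁ p hp q hq (congrArg Prod.fst e)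

/-- Crossing edges with both ends in distinct classes of a partition form a matching. -/
theorem exists_of_labels {ι : Type*} (lab : V → ι) (I : Finset ι) (U : Set V)
    (h : ∀ i ∈ I, ∃ x y, G.Adj x y ∧ x ∈ S ∧ y ∉ S ∧ x ∈ U ∧ y ∈ U ∧ lab x = i ∧ lab y = i) :
    ∃ P, IsCrossingMatching G S P ∧ P.card = I.card ∧ ∀ q ∈ P, q.1 ∈ U ∧ q.2 ∈ U := by
  classical
  rcases I.eq_empty_or_nonempty with rfl | ⟨i₀, hi₀⟩
  · exact ⟨∅, empty, rfl, by simp⟩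
  have : Nonempty V := ⟨(h i₀ hi₀).choose⟩
  choose! x y h using h
  have hinj : ∀ i ∈ I, ∀ j ∈ I, x i = x j → i = j := fun i hi j hj e => by
    rw [← (h i hi).2.2.2.2.2.1, ← (h j hj).2.2.2.2.2.1, e]
  refine ⟨I.image fun i => (x i, y i), ⟨?_, ?_, ?_, ?_, ?_⟩, ?_, ?_⟩
  · simp only [Finset.forall_mem_image]
    exact fun i hi => (h i hi).1
  · simp only [Finset.forall_mem_image]
    exact fun i hi => (h i hi).2.1
  · simp only [Finset.forall_mem_image]
    exact fun i hi => (h i hi).2.2.1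
  · intro p hp q hq e
    obtain ⟨i, hi, rfl⟩ := Finset.mem_image.1 hp
    obtain ⟨j, hj, rfl⟩ := Finset.mem_image.1 hq
    rw [hinj i hi j hj e]
  · intro p hp q hq e
    obtain ⟨i, hi, rfl⟩ := Finset.mem_image.1 hp
    obtain ⟨j, hj, rfl⟩ := Finset.mem_image.1 hq
    have : i = j := by
      rw [← (h i hi).2.2.2.2.2.2, ← (h j hj).2.2.2.2.2.2]
      exact congrArg lab e
    rw [this]
  · exact Finset.card_image_of_injOn fun i hi j hj e => hinj i hi j hj (congrArg Prod.fst e)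
  · simp only [Finset.forall_mem_image]
    exact fun i hi => ⟨(h i hi).2.2.2.1, (h i hi).2.2.2.2.1⟩

end IsCrossingMatching

/-! ### The ternary tree times a path: counting and single crossing edges -/

/-- The infinite rooted tree in which every node has three children. -/
def wordTree : SimpleGraph (List (Fin 3)) where
  Adj l m := (∃ a, l = a :: m) ∨ ∃ a, m = a :: l
  symm := ⟨fun _ _ h => h.symm⟩
  loopless := ⟨by rintro l (⟨a, h⟩ | ⟨a, h⟩) <;> simpa using congrArg List.length h⟩

theorem wordTree_adj_cons (a : Fin 3) (l : List (Fin 3)) : wordTree.Adj (a :: l) l :=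
  Or.inl ⟨a, rfl⟩

/-- The words of length at most `h`, the nodes of the complete ternary tree of height `h`. -/
noncomputable def words (h : ℕ) : Finset (List (Fin 3)) :=
  (List.finite_length_le (Fin 3) h).toFinset

theorem mem_words {h : ℕ} {l : List (Fin 3)} : l ∈ words h ↔ l.length ≤ h := by
  simp [words]

theorem succ_le_card_words (h : ℕ) : h + 1 ≤ (words h).card := by
  rw [← Finset.card_range (h + 1)]
  refine Finset.card_le_card_of_injOn (fun i => List.replicate i 0) (fun i hi => ?_) ?_
  · have := Finset.mem_range.1 hi
    simp only [Finset.mem_coe, mem_words, List.length_replicate]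
    omega
  · intro i _ j _ e
    simpa using congrArg List.length e

theorem card_words_le (h : ℕ) : (words h).card ≤ 4 ^ h := by
  have : (Fintype.card (Fin h → Option (Fin 3))) = 4 ^ h := by simp
  rw [← this, ← Finset.card_univ]
  -- A word of length at most `h` is determined by its entries at positions below `h`, read as
  -- `none` past its end.
  refine Finset.card_le_card_of_injOn (fun l i => l[i.1]?) (fun _ _ => Finset.mem_univ _) ?_
  intro l hl m hm e
  rw [Finset.mem_coe, mem_words] at hl hm
  refine List.ext_getElem? fun i => ?_
  by_cases hi : i < h
  · exact congrFun e ⟨i, hi⟩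
  · rw [List.getElem?_eq_none (by omega), List.getElem?_eq_none (by omega)]

/-- The product of the ternary tree with a path. -/
abbrev treePath (p : ℕ) : SimpleGraph (List (Fin 3) × Fin p) := wordTree □ SimpleGraph.pathGraph p

/-- Deleting first letters walks from `l` to the root inside `W`, so membership in `T` changes at
some step. -/
theorem exists_boundary_of_tail_closed {W : Finset (List (Fin 3))}
    (hW : ∀ a l, a :: l ∈ W → l ∈ W) (T : Set (List (Fin 3))) {l : List (Fin 3)} (hl : l ∈ W)
    (hT : ¬(l ∈ T ↔ [] ∈ T)) : ∃ a m, a :: m ∈ W ∧ ¬(a :: m ∈ T ↔ m ∈ T) := by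
  induction l with
  | nil => exact absurd Iff.rfl hT
  | cons a m ih =>
    by_cases h : a :: m ∈ T ↔ m ∈ T
    · exact ih (hW a m hl) fun h' => hT (h.trans h')
    · exact ⟨a, m, hl, h⟩

/-- One of `l` and `m` is on the other side from the root of the row, and the walk from it to the
root crosses the cut. -/
theorem exists_crossing_edge_row {p : ℕ} {W : Finset (List (Fin 3))}
    (hW : ∀ a l, a :: l ∈ W → l ∈ W) (S : Set (List (Fin 3) × Fin p)) {i : Fin p}
    {l m : List (Fin 3)} (hl : l ∈ W) (hm : m ∈ W) (hlS : (l, i) ∈ S) (hmS : (m, i) ∉ S) :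
    ∃ x y : List (Fin 3) × Fin p, (treePath p).Adj x y ∧ x ∈ S ∧ y ∉ S ∧ x.1 ∈ W ∧ y.1 ∈ W ∧
      x.2 = i ∧ y.2 = i := by
  obtain ⟨a, n, hn, hT⟩ : ∃ a n, a :: n ∈ W ∧
      ¬(a :: n ∈ {l | (l, i) ∈ S} ↔ n ∈ {l | (l, i) ∈ S}) := by
    by_cases h : ([], i) ∈ S
    · exact exists_boundary_of_tail_closed hW _ hm fun h' => hmS (h'.2 h)
    · exact exists_boundary_of_tail_closed hW _ hl fun h' => h (h'.1 hlS)
  have hadj : (treePath p).Adj (a :: n, i) (n, i) :=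
    SimpleGraph.boxProd_adj.2 (Or.inl ⟨wordTree_adj_cons a n, rfl⟩)
  by_cases h : (n, i) ∈ S
  · exact ⟨_, _, hadj.symm, h, fun h' => hT ⟨fun _ => h, fun _ => h'⟩, hW a n hn, hn, rfl, rfl⟩
  · by_cases h' : (a :: n, i) ∈ S
    · exact ⟨_, _, hadj, h', h, hn, hW a n hn, rfl, rfl⟩
    · exact absurd ⟨fun h'' => absurd h'' h', fun h'' => absurd h'' h⟩ hT

theorem exists_crossing_edge_column {p : ℕ} (S : Set (List (Fin 3) × Fin p)) {l : List (Fin 3)}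
    {i j : Fin p} (hi : (l, i) ∈ S) (hj : (l, j) ∉ S) :
    ∃ x y : List (Fin 3) × Fin p, (treePath p).Adj x y ∧ x ∈ S ∧ y ∉ S ∧ x.1 = l ∧ y.1 = l := by
  obtain ⟨w⟩ := SimpleGraph.pathGraph_preconnected p i j
  obtain ⟨d, -, h₁, h₂⟩ := w.exists_boundary_dart {i | (l, i) ∈ S} hi hj
  exact ⟨(l, d.fst), (l, d.snd), SimpleGraph.boxProd_adj.2 (Or.inr ⟨d.adj, rfl⟩), h₁, h₂, rfl, rfl⟩

open Classical in
/-- If both sides of a bipartition of a subtree times a path with `p` vertices have at least `p ^ 2`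
elements, then at least `p` disjoint edges cross the bipartition: one in each row, or many in
distinct columns. -/
theorem exists_crossingMatching_of_sq_le {p : ℕ} (hp : 0 < p) {W : Finset (List (Fin 3))}
    (hW : ∀ a l, a :: l ∈ W → l ∈ W) (S : Set (List (Fin 3) × Fin p))
    (h₁ : p ^ 2 ≤ ((W ×ˢ Finset.univ).filter (· ∈ S)).card)
    (h₂ : p ^ 2 ≤ ((W ×ˢ Finset.univ).filter (· ∉ S)).card) :
    ∃ P, IsCrossingMatching (treePath p) S P ∧ p ≤ P.card ∧ ∀ q ∈ P, q.1.1 ∈ W ∧ q.2.1 ∈ W := by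
  -- Pigeonhole: a column has only `p` vertices, so `p ^ 2` vertices meet at least `p` columns.
  have hcol : ∀ T : List (Fin 3) × Fin p → Prop,
      p ^ 2 ≤ ((W ×ˢ Finset.univ).filter T).card →
      ∃ I ⊆ W, p ≤ I.card ∧ ∀ l ∈ I, ∃ j, T (l, j) := by
    intro T hT
    refine ⟨W.filter fun l => ∃ j, T (l, j), Finset.filter_subset _ _, ?_,
      fun l hl => (Finset.mem_filter.1 hl).2⟩
    have hsub : (W ×ˢ Finset.univ).filter T ⊆
        (W.filter fun l => ∃ j, T (l, j)) ×ˢ (Finset.univ : Finset (Fin p)) := by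
      rintro ⟨l, j⟩ h
      simp only [Finset.mem_filter, Finset.mem_product, Finset.mem_univ, and_true] at h ⊢
      exact ⟨h.1, j, h.2⟩
    have := hT.trans (Finset.card_le_card hsub)
    rw [Finset.card_product, Finset.card_univ, Fintype.card_fin, sq] at this
    exact Nat.le_of_mul_le_mul_right this hp
  by_cases hrows : ∀ i : Fin p, (∃ l ∈ W, (l, i) ∈ S) ∧ ∃ m ∈ W, (m, i) ∉ S
  · obtain ⟨P, hP, hc, hU⟩ := IsCrossingMatching.exists_of_labels (G := treePath p) (S := S)
      Prod.snd Finset.univ {x | x.1 ∈ W} fun i _ => by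
        obtain ⟨⟨l, hl, hlS⟩, m, hm, hmS⟩ := hrows i
        exact exists_crossing_edge_row hW S hl hm hlS hmS
    exact ⟨P, hP, by rw [hc]; simp, hU⟩
  -- Some row lies wholly on one side, so every column meeting the opposite side is mixed and
  -- contains a crossing edge.
  · have key : ∀ I : Finset (List (Fin 3)), p ≤ I.card → I ⊆ W →
        (∀ l ∈ I, (∃ j, (l, j) ∈ S) ∧ ∃ j, (l, j) ∉ S) →
        ∃ P, IsCrossingMatching (treePath p) S P ∧ p ≤ P.card ∧
          ∀ q ∈ P, q.1.1 ∈ W ∧ q.2.1 ∈ W := by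
      intro I hI hIW h
      obtain ⟨P, hP, hc, hU⟩ := IsCrossingMatching.exists_of_labels (G := treePath p) (S := S)
        Prod.fst I {x | x.1 ∈ W} fun l hl => by
          obtain ⟨⟨i, hi⟩, j, hj⟩ := h l hl
          obtain ⟨x, y, hxy, hx, hy, hxl, hyl⟩ := exists_crossing_edge_column S hi hj
          exact ⟨x, y, hxy, hx, hy, by rw [← hxl] at hl; exact hIW hl,
            by rw [← hyl] at hl; exact hIW hl, hxl, hyl⟩
      exact ⟨P, hP, by rw [hc]; exact hI, hU⟩
    obtain ⟨i, hi⟩ := not_forall.1 hrows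
    rcases not_and_or.1 hi with hi | hi
    · push Not at hi
      obtain ⟨I, hIW, hI, hIT⟩ := hcol (· ∈ S) (by convert h₁)
      refine key I hI hIW fun l hl => ?_
      obtain ⟨j, hj⟩ := hIT l hl
      exact ⟨⟨j, hj⟩, i, hi l (hIW hl)⟩
    · push Not at hi
      obtain ⟨I, hIW, hI, hIT⟩ := hcol (· ∉ S) (by convert h₂)
      refine key I hI hIW fun l hl => ?_
      obtain ⟨j, hj⟩ := hIT l hl
      exact ⟨⟨i, hi l (hIW hl)⟩, j, hj⟩

/-! ### A prefix crossed by a large matching -/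

/-- Since `g` is injective on `A`, raising the threshold by one admits at most one new element, so
the count skips no value. -/
theorem exists_card_filter_lt_eq {α : Type*} {A : Finset α} {g : α → ℕ}
    (hg : Set.InjOn g (A : Set α)) {m : ℕ} (hm : m ≤ A.card) :
    ∃ t, (A.filter fun x => g x < t).card = m := by
  classical
  have hex : ∃ t, m ≤ (A.filter fun x => g x < t).card := by
    refine ⟨A.sup g + 1, ?_⟩
    rwa [Finset.filter_true_of_mem fun x hx => Nat.lt_succ_of_le (Finset.le_sup hx)]
  refine ⟨Nat.find hex, le_antisymm ?_ (Nat.find_spec hex)⟩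
  cases ht : Nat.find hex with
  | zero => simp
  | succ t =>
    have hlt : (A.filter fun x => g x < t).card < m :=
      not_le.1 (Nat.find_min hex (by omega))
    have hsub : A.filter (fun x => g x < t + 1) ⊆
        A.filter (fun x => g x < t) ∪ A.filter fun x => g x = t := by
      intro x hx
      simp only [Finset.mem_filter, Finset.mem_union] at hx ⊢
      have := hx.2
      by_cases h : g x = t
      · exact Or.inr ⟨hx.1, h⟩
      · exact Or.inl ⟨hx.1, by omega⟩
    have hone : (A.filter fun x => g x = t).card ≤ 1 := Finset.card_le_one.2 fun x hx y hy => by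
      rw [Finset.mem_filter] at hx hy
      exact hg hx.1 hy.1 (hx.2.trans hy.2.symm)
    have := (Finset.card_le_card hsub).trans (Finset.card_union_le _ _)
    omega

/-- The embedding of the tree times a path as the subtree below the child `b` of the root. -/
def belowChild {p : ℕ} (b : Fin 3) (x : List (Fin 3) × Fin p) : List (Fin 3) × Fin p :=
  (x.1 ++ [b], x.2)

theorem belowChild_injective {p : ℕ} (b : Fin 3) :
    Function.Injective (belowChild b : List (Fin 3) × Fin p → _) := by
  rintro ⟨l, i⟩ ⟨m, j⟩ h
  simpa [belowChild] using h

theorem belowChild_adj {p : ℕ} (b : Fin 3) {x y : List (Fin 3) × Fin p}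
    (h : (treePath p).Adj x y) : (treePath p).Adj (belowChild b x) (belowChild b y) := by
  rw [SimpleGraph.boxProd_adj] at h ⊢
  rcases h with ⟨h | h, e⟩ | ⟨h, e⟩
  · obtain ⟨a, h⟩ := h
    exact Or.inl ⟨Or.inl ⟨a, by simp [belowChild, h]⟩, e⟩
  · obtain ⟨a, h⟩ := h
    exact Or.inl ⟨Or.inr ⟨a, by simp [belowChild, h]⟩, e⟩
  · exact Or.inr ⟨h, by simp [belowChild, e]⟩

/-- For every injective ranking of the complete ternary tree of height `2 * p + h` times a path with
`p` vertices, some initial segment is crossed by a matching of size at least `h * p`. -/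
theorem exists_initialSegment_crossingMatching {p : ℕ} (hp : 0 < p) (h : ℕ)
    (g : List (Fin 3) × Fin p → ℕ) (hg : Set.InjOn g {x | x.1.length ≤ 2 * p + h}) :
    ∃ t P, IsCrossingMatching (treePath p) {x | g x < t} P ∧ h * p ≤ P.card ∧
      (∀ q ∈ P, q.1.1.length ≤ 2 * p + h ∧ q.2.1.length ≤ 2 * p + h) ∧
      p ^ 2 ≤ ((words (2 * p + h) ×ˢ Finset.univ).filter fun x => g x < t).card ∧
      p ^ 2 ≤ ((words (2 * p + h) ×ˢ Finset.univ).filter fun x => ¬ g x < t).card := by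
  classical
  induction h generalizing g with
  | zero =>
    -- Height `2 * p` serves only to provide `p ^ 2` vertices for each side; the matching is still
    -- empty.
    have hA : 2 * p ^ 2 ≤ (words (2 * p + 0) ×ˢ (Finset.univ : Finset (Fin p))).card := by
      rw [Finset.card_product, Finset.card_univ, Fintype.card_fin, sq, ← mul_assoc]
      exact Nat.mul_le_mul_right p ((Nat.le_succ _).trans (succ_le_card_words _))
    obtain ⟨t, ht⟩ := exists_card_filter_lt_eq (m := p ^ 2) (g := g)
      (A := words (2 * p + 0) ×ˢ (Finset.univ : Finset (Fin p)))
      (hg.mono fun x hx => mem_words.1 (Finset.mem_product.1 hx).1) (by omega)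
    refine ⟨t, ∅, IsCrossingMatching.empty, by simp, by simp, ht.ge, ?_⟩
    have := Finset.card_filter_add_card_filter_not
      (s := words (2 * p + 0) ×ˢ (Finset.univ : Finset (Fin p))) (fun x => g x < t)
    omega
  | succ h ih =>
    have hlen : ∀ (b : Fin 3) (x : List (Fin 3) × Fin p), x.1.length ≤ 2 * p + h →
        (belowChild b x).1.length ≤ 2 * p + (h + 1) := by
      intro b x hx
      simp only [belowChild, List.length_append, List.length_singleton]
      omega
    choose t P hP hcard hPlen hlow hhigh using fun b : Fin 3 =>
      ih (g ∘ belowChild b) (hg.comp (belowChild_injective b).injOn fun x hx => hlen b x hx)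
    -- The subtree `b` with the middle threshold supplies the cut. Subtree `a` then has `p ^ 2`
    -- vertices below the cut, and subtree `c` has `p ^ 2` at or above it.
    obtain ⟨a, b, c, hab, hcb, htab, htbc⟩ :
        ∃ a b c : Fin 3, a ≠ b ∧ c ≠ b ∧ t a ≤ t b ∧ t b ≤ t c := by
      have hmono := Tuple.monotone_sort t
      refine ⟨Tuple.sort t 0, Tuple.sort t 1, Tuple.sort t 2, ?_, ?_, hmono (by decide),
        hmono (by decide)⟩ <;> simp
    obtain ⟨hPb, hPbcard⟩ := (hP b).image (G' := treePath p) (S' := {x | g x < t b})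
      (U := Set.univ) (fun _ _ => ⟨trivial, trivial⟩) (belowChild_injective b).injOn
      (fun _ _ _ _ h => belowChild_adj b h) (fun _ _ => Iff.rfl)
    -- The tree without the subtree below `b`: words grow at the head, so the last letter names the
    -- child of the root. It is closed under parents, and its crossing edges are disjoint from those
    -- in subtree `b`.
    set W := (words (2 * p + (h + 1))).filter fun l => l.getLast? ≠ some b with hWdef
    have hW : ∀ a l, a :: l ∈ W → l ∈ W := by
      intro a l hl
      simp only [hWdef, Finset.mem_filter, mem_words, List.length_cons, List.getLast?_cons] at hl ⊢
      refine ⟨by omega, fun h' => hl.2 (by simp [h'])⟩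
    have hmemW : ∀ a, a ≠ b → ∀ x : List (Fin 3) × Fin p, x.1.length ≤ 2 * p + h →
        (belowChild a x).1 ∈ W := by
      intro a ha x hx
      simp only [hWdef, Finset.mem_filter, mem_words]
      exact ⟨hlen a x hx, by simpa [belowChild] using ha⟩
    have hcount : ∀ (a : Fin 3) (p₁ p₂ : List (Fin 3) × Fin p → Prop) (W' : Finset (List (Fin 3))),
        [DecidablePred p₁] → [DecidablePred p₂] → (∀ x, p₁ x → p₂ (belowChild a x)) →
        (∀ x : List (Fin 3) × Fin p, x.1.length ≤ 2 * p + h → (belowChild a x).1 ∈ W') →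
        ((words (2 * p + h) ×ˢ Finset.univ).filter p₁).card ≤
          ((W' ×ˢ Finset.univ).filter p₂).card := by
      intro a p₁ p₂ W' _ _ h₁ h₂
      refine Finset.card_le_card_of_injOn (belowChild a) (fun x hx => ?_)
        (belowChild_injective a).injOn
      simp only [Finset.coe_filter, Set.mem_ofPred_eq, Finset.mem_product, Finset.mem_univ, and_true,
        mem_words] at hx ⊢
      exact ⟨h₂ x hx.1, h₁ x hx.2⟩
    obtain ⟨Q, hQ, hQcard, hQW⟩ := exists_crossingMatching_of_sq_le hp hW {x | g x < t b}
      (by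
        convert Nat.le_trans (hlow a) (hcount a (fun x => (g ∘ belowChild a) x < t a)
          (fun x => x ∈ {x | g x < t b}) W (fun x hx => lt_of_lt_of_le hx htab) (hmemW a hab)))
      (by
        convert Nat.le_trans (hhigh c) (hcount c (fun x => ¬ (g ∘ belowChild c) x < t c)
          (fun x => x ∉ {x | g x < t b}) W (fun x hx hx' => hx (lt_of_lt_of_le hx' htbc))
          (hmemW c hcb)))
    have hne : ∀ (x : List (Fin 3) × Fin p), ∀ y : List (Fin 3) × Fin p, y.1 ∈ W →
        belowChild b x ≠ y := by
      rintro x y hy rfl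
      exact (Finset.mem_filter.1 hy).2 (by simp [belowChild])
    have h₁ : ∀ q ∈ (P b).image (Prod.map (belowChild b) (belowChild b)), ∀ r ∈ Q,
        q.1 ≠ r.1 := by
      simp only [Finset.forall_mem_image]
      exact fun q _ r hr => hne _ _ (hQW r hr).1
    have h₂ : ∀ q ∈ (P b).image (Prod.map (belowChild b) (belowChild b)), ∀ r ∈ Q,
        q.2 ≠ r.2 := by
      simp only [Finset.forall_mem_image]
      exact fun q _ r hr => hne _ _ (hQW r hr).2
    refine ⟨t b, _, hPb.union hQ h₁ h₂, ?_, ?_, ?_, ?_⟩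
    · rw [Finset.card_union_of_disjoint
        (Finset.disjoint_left.2 fun q hq hq' => h₁ q hq q hq' rfl), hPbcard]
      have := hcard b
      rw [add_mul, one_mul]
      omega
    · intro q hq
      rcases Finset.mem_union.1 hq with hq | hq
      · obtain ⟨r, hr, rfl⟩ := Finset.mem_image.1 hq
        exact ⟨hlen b _ (hPlen b r hr).1, hlen b _ (hPlen b r hr).2⟩
      · exact ⟨mem_words.1 (Finset.mem_filter.1 (hQW q hq).1).1,
          mem_words.1 (Finset.mem_filter.1 (hQW q hq).2).1⟩
    · exact (hlow b).trans (hcount b _ _ _ (fun _ h => h) fun x hx => mem_words.2 (hlen b x hx))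
    · exact (hhigh b).trans (hcount b _ _ _ (fun _ h => h) fun x hx => mem_words.2 (hlen b x hx))

/-! ### Induced crossing matchings -/

/-- The only edges of `G` between vertices covered by `P` are the pairs in `P` themselves. -/
def IsInducedPairs {V : Type*} (G : SimpleGraph V) (P : Finset (V × V)) : Prop :=
  ∀ q ∈ P, ∀ r ∈ P, q ≠ r → ¬ G.Adj q.1 r.1 ∧ ¬ G.Adj q.1 r.2 ∧ ¬ G.Adj q.2 r.2

theorem IsInducedPairs.mono {V : Type*} {G : SimpleGraph V} {P Q : Finset (V × V)}
    (h : IsInducedPairs G P) (hQ : Q ⊆ P) : IsInducedPairs G Q :=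
  fun q hq r hr => h q (hQ hq) r (hQ hr)

/-- In a graph with all degrees at most `d`, a crossing matching contains an induced one of
proportional size. -/
theorem IsCrossingMatching.exists_induced {V : Type*} {G : SimpleGraph V} {S : Set V}
    {P : Finset (V × V)} (hP : IsCrossingMatching G S P) {d : ℕ} (N : V → Finset V)
    (hN : ∀ u, (N u).card ≤ d) (hadj : ∀ u v, G.Adj u v → v ∈ N u) :
    ∃ I ⊆ P, IsInducedPairs G I ∧ P.card ≤ I.card * (4 * d) := by
  classical
  -- By maximality every edge of `P` has an end adjacent to an end of some edge of `I`. The two ends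
  -- of that edge have at most `2 * d` neighbors, each the first end of at most one edge of `P` and
  -- the second end of at most one, whence `4 * d`.
  obtain ⟨I, hI, hmax⟩ := (P.powerset.filter (IsInducedPairs G)).exists_max_image Finset.card
    ⟨∅, by simp [IsInducedPairs]⟩
  rw [Finset.mem_filter, Finset.mem_powerset] at hI
  refine ⟨I, hI.1, hI.2, ?_⟩
  let conf : V × V → V × V → Prop := fun q r =>
    (G.Adj q.1 r.1 ∨ G.Adj q.2 r.1) ∨ (G.Adj q.1 r.2 ∨ G.Adj q.2 r.2)
  have hsub : P ⊆ I.biUnion fun q => P.filter (conf q) := by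
    intro r hr
    simp only [Finset.mem_biUnion, Finset.mem_filter]
    by_contra! hcon
    have hno : ∀ q ∈ I, ¬ conf q r := fun q hq => hcon q hq hr
    have hrI : r ∉ I := fun h => hno r h (Or.inr (Or.inl (hP.adj r hr)))
    have hins : insert r I ∈ P.powerset.filter (IsInducedPairs G) := by
      rw [Finset.mem_filter, Finset.mem_powerset]
      refine ⟨Finset.insert_subset hr hI.1, ?_⟩
      intro q hq q' hq' hne
      rcases Finset.mem_insert.1 hq with rfl | hqI <;>
        rcases Finset.mem_insert.1 hq' with rfl | hqI'
      · exact absurd rfl hne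
      · exact ⟨fun h => hno q' hqI' (Or.inl (Or.inl h.symm)),
          fun h => hno q' hqI' (Or.inl (Or.inr h.symm)),
          fun h => hno q' hqI' (Or.inr (Or.inr h.symm))⟩
      · exact ⟨fun h => hno q hqI (Or.inl (Or.inl h)), fun h => hno q hqI (Or.inr (Or.inl h)),
          fun h => hno q hqI (Or.inr (Or.inr h))⟩
      · exact hI.2 q hqI q' hqI' hne
    have := hmax _ hins
    rw [Finset.card_insert_of_notMem hrI] at this
    omega
  refine (Finset.card_le_card hsub).trans (Finset.card_biUnion_le_card_mul _ _ _ fun q _ => ?_)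
  have hun : ∀ u v, (N u ∪ N v).card ≤ 2 * d := fun u v =>
    (Finset.card_union_le _ _).trans (by have := hN u; have := hN v; omega)
  have h₁ : (P.filter fun r => G.Adj q.1 r.1 ∨ G.Adj q.2 r.1).card ≤ 2 * d := by
    refine (Finset.card_le_card_of_injOn Prod.fst (fun r hr => ?_)
      (hP.injOn_fst.mono (Finset.coe_subset.2 (Finset.filter_subset _ _)))).trans (hun q.1 q.2)
    exact Finset.mem_union.2 ((Finset.mem_filter.1 hr).2.imp (hadj _ _) (hadj _ _))
  have h₂ : (P.filter fun r => G.Adj q.1 r.2 ∨ G.Adj q.2 r.2).card ≤ 2 * d := by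
    refine (Finset.card_le_card_of_injOn Prod.snd (fun r hr => ?_)
      (hP.injOn_snd.mono (Finset.coe_subset.2 (Finset.filter_subset _ _)))).trans (hun q.1 q.2)
    exact Finset.mem_union.2 ((Finset.mem_filter.1 hr).2.imp (hadj _ _) (hadj _ _))
  have h₃ : P.filter (conf q) = (P.filter fun r => G.Adj q.1 r.1 ∨ G.Adj q.2 r.1) ∪
      P.filter fun r => G.Adj q.1 r.2 ∨ G.Adj q.2 r.2 := Finset.filter_or _ _ _
  have := Finset.card_union_le (P.filter fun r => G.Adj q.1 r.1 ∨ G.Adj q.2 r.1)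
      (P.filter fun r => G.Adj q.1 r.2 ∨ G.Adj q.2 r.2)
  rw [h₃]
  omega

/-- The subgraph formed by the edges of a crossing matching. -/
def IsCrossingMatching.toSubgraph {V : Type*} {G : SimpleGraph V} {S : Set V} {P : Finset (V × V)}
    (hP : IsCrossingMatching G S P) : G.Subgraph where
  verts := {v | ∃ q ∈ P, v = q.1 ∨ v = q.2}
  Adj u v := ∃ q ∈ P, u = q.1 ∧ v = q.2 ∨ u = q.2 ∧ v = q.1
  adj_sub := by
    rintro u v ⟨q, hq, ⟨rfl, rfl⟩ | ⟨rfl, rfl⟩⟩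
    · exact hP.adj q hq
    · exact (hP.adj q hq).symm
  edge_vert := by
    rintro u v ⟨q, hq, ⟨rfl, rfl⟩ | ⟨rfl, rfl⟩⟩
    · exact ⟨q, hq, Or.inl rfl⟩
    · exact ⟨q, hq, Or.inr rfl⟩
  symm := ⟨by
    rintro u v ⟨q, hq, h⟩
    exact ⟨q, hq, h.symm.imp And.symm And.symm⟩⟩

theorem IsCrossingMatching.card_le_orderLsimWidth {V : Type*} [Finite V] {G : SimpleGraph V}
    {S : Set V} {P : Finset (V × V)} (hP : IsCrossingMatching G S P) (hI : IsInducedPairs G P)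
    (π : LinearOrder V) (hS : ∀ u ∈ S, ∀ v, π.le v u → v ∈ S) :
    P.card ≤ orderLsimWidth G π := by
  have hne : ∀ q ∈ P, ∀ r ∈ P, q.1 ≠ r.2 := fun q hq r hr h =>
    hP.snd_notMem r hr (h ▸ hP.fst_mem q hq)
  refine le_csSup ⟨Nat.card (Sym2 V), ?_⟩ ⟨hP.toSubgraph, ⟨?_, ?_⟩, ⟨S, hS, ?_⟩, ?_⟩
  -- The supremum in `ℕ` is meaningful only because the sizes are bounded.
  · rintro m ⟨M, -, -, rfl⟩
    exact Set.ncard_le_card _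
  · rintro v ⟨q, hq, rfl | rfl⟩
    · refine ⟨q.2, ⟨q, hq, Or.inl ⟨rfl, rfl⟩⟩, ?_⟩
      rintro w ⟨r, hr, ⟨h, rfl⟩ | ⟨h, rfl⟩⟩
      · rw [hP.injOn_fst hq hr h]
      · exact absurd h (hne q hq r hr)
    · refine ⟨q.1, ⟨q, hq, Or.inr ⟨rfl, rfl⟩⟩, ?_⟩
      rintro w ⟨r, hr, ⟨h, rfl⟩ | ⟨h, rfl⟩⟩
      · exact absurd h.symm (hne r hr q hq)
      · rw [hP.injOn_snd hq hr h]
  · rintro u ⟨q, hq, hu⟩ v ⟨r, hr, hv⟩ huv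
    have hqr : q = r := by
      by_contra hqr
      obtain ⟨h₁, h₂, h₃⟩ := hI q hq r hr hqr
      have h₄ := (hI r hr q hq (Ne.symm hqr)).2.1
      rcases hu with rfl | rfl <;> rcases hv with rfl | rfl
      · exact h₁ huv
      · exact h₂ huv
      · exact h₄ huv.symm
      · exact h₃ huv
    subst hqr
    rcases hu with rfl | rfl <;> rcases hv with rfl | rfl
    · exact absurd huv G.irrefl
    · exact ⟨q, hq, Or.inl ⟨rfl, rfl⟩⟩
    · exact ⟨q, hq, Or.inr ⟨rfl, rfl⟩⟩
    · exact absurd huv G.irrefl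
  · rintro u v ⟨q, hq, ⟨rfl, rfl⟩ | ⟨rfl, rfl⟩⟩
    · exact iff_of_true (hP.fst_mem q hq) (hP.snd_notMem q hq)
    · exact iff_of_false (hP.snd_notMem q hq) (not_not.2 (hP.fst_mem q hq))
  · have : hP.toSubgraph.edgeSet = (fun q : V × V => s(q.1, q.2)) '' (P : Set (V × V)) := by
      ext e
      induction e with
      | _ u v =>
        simp only [SimpleGraph.Subgraph.mem_edgeSet, Set.mem_image, Finset.mem_coe, Sym2.eq_iff]
        constructor
        · rintro ⟨q, hq, h⟩
          exact ⟨q, hq, by rcases h with ⟨rfl, rfl⟩ | ⟨rfl, rfl⟩ <;> simp⟩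
        · rintro ⟨q, hq, h⟩
          exact ⟨q, hq, by rcases h with ⟨rfl, rfl⟩ | ⟨rfl, rfl⟩ <;> simp⟩
    rw [this, Set.InjOn.ncard_image, Set.ncard_coe_finset]
    intro q hq r hr h
    rcases Sym2.eq_iff.1 h with ⟨h, -⟩ | ⟨h, -⟩
    · exact hP.injOn_fst hq hr h
    · exact absurd h (hne q hq r hr)

/-! ### Matchings in graphs isomorphic to a ternary tree times a path -/

section Comap

variable {V : Type*} {p : ℕ} {f : V → List (Fin 3) × Fin p}

theorem exists_neighbors_treePath [Fintype V] (hf : Function.Injective f) :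
    ∃ N : V → Finset V, (∀ u, (N u).card ≤ 6) ∧
      ∀ u v, ((treePath p).comap f).Adj u v → v ∈ N u := by
  classical
  refine ⟨fun u => Finset.univ.filter (((treePath p).comap f).Adj u), fun u => ?_,
    fun u v h => Finset.mem_filter.2 ⟨Finset.mem_univ v, h⟩⟩
  rcases hu : f u with ⟨l, i⟩
  -- Candidate neighbors: the parent, three children and two along the path. The default values of
  -- `tail` at the root and of `i.1 - 1` at zero merely enlarge the list.
  refine (Finset.card_le_card_of_injOn (fun v => ((f v).1, ((f v).2 : ℕ)))
    (t := {(l.tail, i.1), (0 :: l, i.1), (1 :: l, i.1), (2 :: l, i.1), (l, i.1 + 1), (l, i.1 - 1)})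
    (fun v hv => ?_) ?_).trans Finset.card_le_six
  · have h : (treePath p).Adj (f u) (f v) := (Finset.mem_filter.1 hv).2
    obtain ⟨m, j⟩ := f v
    rw [hu, SimpleGraph.boxProd_adj] at h
    simp only [Finset.coe_insert, Finset.coe_singleton, Set.mem_insert_iff, Set.mem_singleton_iff,
      Prod.mk.injEq]
    rcases h with ⟨⟨a, h⟩ | ⟨a, h⟩, rfl⟩ | ⟨h, rfl⟩
    · simp only at h
      simp [h]
    · simp only at h
      fin_cases a <;> simp [h]
    · rcases SimpleGraph.pathGraph_adj.1 h with h | h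
      · simp only at h
        simp [← h]
      · simp only at h
        simp [← h]
  · intro v _ w _ h
    simp only [Prod.mk.injEq] at h
    exact hf (Prod.ext h.1 (Fin.ext h.2))

/-- The color is the parity of depth plus position on the path. -/
theorem exists_twoColoring_treePath (f : V → List (Fin 3) × Fin p) :
    ∃ χ : V → Fin 2, ∀ u v, ((treePath p).comap f).Adj u v → χ u ≠ χ v := by
  have key : ∀ x y, (treePath p).Adj x y →
      (Even (x.1.length + x.2.1) ↔ ¬ Even (y.1.length + y.2.1)) := by
    rintro ⟨l, i⟩ ⟨m, j⟩ h
    rw [SimpleGraph.boxProd_adj] at h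
    rcases h with ⟨⟨a, h⟩ | ⟨a, h⟩, rfl⟩ | ⟨h, rfl⟩
    · simp only at h
      simp only [h, List.length_cons]
      grind
    · simp only at h
      simp only [h, List.length_cons]
      grind
    · have := SimpleGraph.pathGraph_adj.1 h
      simp only at this ⊢
      grind
  refine ⟨fun v => if Even ((f v).1.length + (f v).2.1) then 0 else 1, fun u v h => ?_⟩
  have := key _ _ h
  by_cases hv : Even ((f v).1.length + (f v).2.1)
  · simp [hv, this]
  · simp [hv, this]

/-- Every linear order of a ternary tree times a path has a prefix crossed by a large induced
matching, and its edges may be taken to lead from one color class of a 2-coloring to the other. -/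
theorem exists_prefix_inducedMatching [Fintype V] (hp : 0 < p) (h : ℕ)
    (hf : Function.Injective f) (hrange : ∀ x, (∃ v, f v = x) ↔ x.1.length ≤ 2 * p + h)
    (χ : V → Fin 2) (π : LinearOrder V) :
    ∃ S : Set V, (∀ u ∈ S, ∀ v, π.le v u → v ∈ S) ∧ ∃ P a,
      IsCrossingMatching ((treePath p).comap f) S P ∧ IsInducedPairs ((treePath p).comap f) P ∧
      (∀ q ∈ P, χ q.1 = a) ∧ h * p ≤ 48 * P.card := by
  classical
  have : Nonempty V := ⟨((hrange ([], ⟨0, hp⟩)).2 (by simp)).choose⟩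
  let rank : V → ℕ := fun v => (Finset.univ.filter fun u => π.lt u v).card
  have hmono : ∀ u v, π.lt u v → rank u < rank v := fun u v huv =>
    Finset.card_lt_card ⟨fun w hw => by
      rw [Finset.mem_filter] at hw ⊢
      exact ⟨hw.1, @lt_trans V π.toPreorder _ _ _ hw.2 huv⟩, fun hsub => by
      have := hsub (Finset.mem_filter.2 ⟨Finset.mem_univ u, huv⟩)
      exact @lt_irrefl V π.toPreorder u (Finset.mem_filter.1 this).2⟩
  have hmono' : ∀ u v, π.le u v → rank u ≤ rank v := fun u v huv => by
    rcases @eq_or_lt_of_le V π.toPartialOrder _ _ huv with rfl | h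
    · exact le_rfl
    · exact (hmono u v h).le
  have hinj : Function.Injective rank := fun u v huv => by
    rcases @lt_trichotomy V π u v with h | h | h
    · exact absurd huv (hmono u v h).ne
    · exact h
    · exact absurd huv (hmono v u h).ne'
  -- The ranking is moved to pairs along `f`; its value 0 off the range of `f` never matters.
  have hext : ∀ v, Function.extend f rank 0 (f v) = rank v := hf.extend_apply rank 0
  obtain ⟨t, P, hP, hcard, hlen, -, -⟩ := exists_initialSegment_crossingMatching hp h
    (Function.extend f rank 0) (by
      intro x hx y hy hxy
      obtain ⟨u, rfl⟩ := (hrange x).2 hx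
      obtain ⟨v, rfl⟩ := (hrange y).2 hy
      rw [hext, hext] at hxy
      rw [hinj hxy])
  have hinv : ∀ v, Function.invFun f (f v) = v := Function.leftInverse_invFun hf
  obtain ⟨hQ, hQcard⟩ := hP.image (G' := (treePath p).comap f) (S' := {v | rank v < t})
    (U := {x : List (Fin 3) × Fin p | x.1.length ≤ 2 * p + h}) (f := Function.invFun f)
    (fun q hq => hlen q hq)
    (by
      intro x hx y hy hxy
      obtain ⟨u, rfl⟩ := (hrange x).2 hx
      obtain ⟨v, rfl⟩ := (hrange y).2 hy
      rw [hinv, hinv] at hxy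
      rw [hxy])
    (by
      intro x hx y hy hxy
      obtain ⟨u, rfl⟩ := (hrange x).2 hx
      obtain ⟨v, rfl⟩ := (hrange y).2 hy
      rwa [hinv, hinv])
    (by
      intro x hx
      obtain ⟨u, rfl⟩ := (hrange x).2 hx
      rw [hinv]
      simp only [Set.mem_ofPred_eq, hext])
  obtain ⟨N, hN, hadj⟩ := exists_neighbors_treePath hf
  obtain ⟨I, hIQ, hI, hIcard⟩ := hQ.exists_induced N hN hadj
  -- Keeping the majority color of first ends costs a factor 2; with the factor `4 * 6` of the
  -- induced submatching this gives 48.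
  have hsplit : ∃ a, I.card ≤ 2 * (I.filter fun q => χ q.1 = a).card := by
    by_contra! hcon
    have h₀ := hcon 0
    have h₁ := hcon 1
    have hsum := Finset.card_filter_add_card_filter_not (s := I) (fun q => χ q.1 = 0)
    have : I.filter (fun q => ¬ χ q.1 = 0) = I.filter fun q => χ q.1 = 1 :=
      Finset.filter_congr fun q _ => by omega
    rw [this] at hsum
    omega
  obtain ⟨a, ha⟩ := hsplit
  refine ⟨{v | rank v < t}, fun u hu v hv => lt_of_le_of_lt (hmono' v u hv) hu, _, a,
    hQ.mono ((Finset.filter_subset (fun q => χ q.1 = a) I).trans hIQ),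
    hI.mono (Finset.filter_subset _ _), fun q hq => (Finset.mem_filter.1 hq).2, ?_⟩
  omega

theorem le_lsimWidth_treePath [Fintype V] (hp : 0 < p) (h : ℕ)
    (hf : Function.Injective f) (hrange : ∀ x, (∃ v, f v = x) ↔ x.1.length ≤ 2 * p + h) :
    h * p ≤ 48 * lsimWidth ((treePath p).comap f) := by
  have : Nonempty (LinearOrder V) :=
    ⟨LinearOrder.lift' (Fintype.equivFin V) (Fintype.equivFin V).injective⟩
  -- The minimum over the orders is attained, since orders exist.
  obtain ⟨π, hπ⟩ := ciInf_mem (fun π : LinearOrder V => orderLsimWidth ((treePath p).comap f) π)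
  obtain ⟨S, hS, P, a, hP, hI, -, hcard⟩ :=
    exists_prefix_inducedMatching hp h hf hrange (fun _ => 0) π
  have := hP.card_le_orderLsimWidth hI π hS
  simp only at hπ
  rw [lsimWidth, ← hπ]
  omega

/-- A diagram for the formula of a ternary tree times a path is large: since this graph is
2-colorable, it is an induced subgraph of its star graph. -/
theorem two_pow_le_size_treePath [Fintype V] [DecidableEq V] (hp : 0 < p) (h : ℕ)
    (hf : Function.Injective f) (hrange : ∀ x, (∃ v, f v = x) ↔ x.1.length ≤ 2 * p + h)
    {B : ConjFBDD (V × Fin 2)} (hB : B.IsConjOBDD)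
    (hrep : B.Represents (psi ((treePath p).comap f))) :
    ∃ m, h * p ≤ 48 * m ∧ 2 ^ m ≤ B.size + 2 := by
  obtain ⟨π, hπ⟩ := hB
  obtain ⟨χ, hχ⟩ := exists_twoColoring_treePath f
  have hg : Function.Injective fun v => (v, χ v) := fun u v h => congrArg Prod.fst h
  -- The order of the variables is pulled back along the embedding given by the coloring. The prefix
  -- found for it generates a prefix of the variables that meets the embedded copy in exactly the
  -- image of `S`.
  obtain ⟨S, hS, P, a, hP, hI, ha, hcard⟩ := exists_prefix_inducedMatching hp h hf hrange χ
    (@LinearOrder.lift' _ _ π (fun v => (v, χ v)) hg)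
  obtain ⟨hQ, hQcard⟩ := hP.image (G' := starGraph ((treePath p).comap f))
    (S' := {x | ∃ u ∈ S, π.le x (u, χ u)}) (U := Set.univ) (fun _ _ => ⟨trivial, trivial⟩)
    hg.injOn (fun u _ v _ huv => ⟨huv, hχ u v huv⟩)
    (fun v _ => ⟨fun ⟨u, hu, hle⟩ => hS u hu v hle, fun hv => ⟨v, hv, π.le_refl _⟩⟩)
  refine ⟨P.card, hcard, ?_⟩
  rw [← hQcard]
  refine two_pow_le_size_of_represents _ hπ hrep (S := {x | ∃ u ∈ S, π.le x (u, χ u)})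
    ?_ _ a (fun q hq => ⟨hQ.adj q hq, hQ.fst_mem q hq, hQ.snd_notMem q hq, ?_⟩) ?_
  · rintro x ⟨u, hu, hx⟩ y hy
    exact ⟨u, hu, π.le_trans _ _ _ hy hx⟩
  · obtain ⟨q, hq', rfl⟩ := Finset.mem_image.1 hq
    exact ha q hq'
  · intro q hq r hr hne
    obtain ⟨q', hq', rfl⟩ := Finset.mem_image.1 hq
    obtain ⟨r', hr', rfl⟩ := Finset.mem_image.1 hr
    exact fun hadj => (hI q' hq' r' hr' fun h => hne (h ▸ rfl)).2.1 hadj.1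

end Comap

/-! ### Tree decompositions -/

/-- The nodes of the complete ternary tree of height `H`. -/
abbrev WordNode (H : ℕ) : Type := ↥{l : List (Fin 3) | l.length ≤ H}

/-! ### The complete ternary tree as index tree -/

namespace WordNode

variable {H : ℕ}

/-- The complete ternary tree of height `H`. -/
abbrev tree (H : ℕ) : SimpleGraph (WordNode H) := wordTree.induce {l | l.length ≤ H}

/-- The parent of a node; the root is its own parent. -/
def parent (t : WordNode H) : WordNode H :=
  ⟨t.1.tail, by
    have := t.2
    simp only [Set.mem_ofPred_eq, List.length_tail] at this ⊢
    omega⟩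

/-- The root of the tree. -/
def root (H : ℕ) : WordNode H := ⟨[], Nat.zero_le H⟩

theorem finite : Finite (WordNode H) := List.finite_length_le (Fin 3) H

theorem adj_parent {t : WordNode H} (ht : t ≠ root H) : (tree H).Adj t (parent t) := by
  obtain ⟨_ | ⟨a, l⟩, hl⟩ := t
  · exact absurd rfl ht
  · exact Or.inl ⟨a, rfl⟩

theorem eq_parent_of_adj {s t : WordNode H} (h : (tree H).Adj s t) :
    s ≠ root H ∧ t = parent s ∨ t ≠ root H ∧ s = parent t := by
  obtain ⟨s, hs⟩ := s
  obtain ⟨t, ht⟩ := t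
  rcases h with ⟨a, h⟩ | ⟨a, h⟩
  · simp only [Function.Embedding.subtype_apply] at h
    subst h
    exact Or.inl ⟨by simp [root], rfl⟩
  · simp only [Function.Embedding.subtype_apply] at h
    subst h
    exact Or.inr ⟨by simp [root], rfl⟩

theorem reachable_parent (t : WordNode H) : (tree H).Reachable t (parent t) := by
  by_cases ht : t = root H
  · subst ht
    exact SimpleGraph.Reachable.refl _
  · exact (adj_parent ht).reachable

/-- Taking parents shortens every nonempty word, so two nodes can be each other's parent only if
both are the root. -/
theorem eq_of_mutual_parent {s t : WordNode H} (hs : s = t ∨ s = parent t)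
    (ht : t = s ∨ t = parent s) : s = t := by
  rcases hs with hs | hs
  · exact hs
  rcases ht with ht | ht
  · exact ht.symm
  have h₁ : s.1 = t.1.tail := congrArg Subtype.val hs
  have h₂ : t.1 = s.1.tail := congrArg Subtype.val ht
  refine Subtype.ext ?_
  have e₁ := congrArg List.length h₁
  have e₂ := congrArg List.length h₂
  rw [List.length_tail] at e₁ e₂
  rw [List.length_eq_zero_iff.1 (show s.1.length = 0 by omega),
    List.length_eq_zero_iff.1 (show t.1.length = 0 by omega)]

theorem tree_connected : (tree H).Connected := by
  rw [SimpleGraph.connected_iff_exists_forall_reachable]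
  refine ⟨root H, ?_⟩
  rintro ⟨l, hl⟩
  induction l with
  | nil => exact SimpleGraph.Reachable.refl _
  | cons a l ih =>
    have hl' : l.length ≤ H := (Nat.le_succ _).trans hl
    exact (ih hl').trans (reachable_parent ⟨a :: l, hl⟩).symm

/-- A connected graph with one edge fewer than nodes is a tree, and the edges correspond to the
non-root nodes through their parent edges. -/
theorem tree_isTree : (tree H).IsTree := by
  have := finite (H := H)
  rw [SimpleGraph.isTree_iff_connected_and_card]
  refine ⟨tree_connected, ?_⟩
  have hedge : (tree H).edgeSet = (fun t => s(t, parent t)) '' {root H}ᶜ := by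
    ext e
    induction e with
    | _ s t =>
      simp only [SimpleGraph.mem_edgeSet, Set.mem_image, Set.mem_compl_iff, Set.mem_singleton_iff]
      constructor
      · intro h
        rcases eq_parent_of_adj h with ⟨hs, rfl⟩ | ⟨ht, rfl⟩
        · exact ⟨s, hs, rfl⟩
        · exact ⟨t, ht, Sym2.eq_swap⟩
      · rintro ⟨r, hr, h⟩
        rcases Sym2.eq_iff.1 h with ⟨rfl, rfl⟩ | ⟨rfl, rfl⟩
        · exact adj_parent hr
        · exact (adj_parent hr).symm
  have hinj : Set.InjOn (fun t : WordNode H => s(t, parent t)) {root H}ᶜ := by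
    intro s _ t _ h
    rcases Sym2.eq_iff.1 h with ⟨h, -⟩ | ⟨h₁, h₂⟩
    · exact h
    · exact eq_of_mutual_parent (Or.inr h₁) (Or.inr h₂.symm)
  change (tree H).edgeSet.ncard + 1 = _
  rw [hedge, hinj.ncard_image, Set.ncard_compl, Set.ncard_singleton]
  have : 0 < Nat.card (WordNode H) := Nat.card_pos_iff.2 ⟨⟨root H⟩, finite⟩
  omega

/-- The set is a star, `s` with its children; these are the bags that will contain the vertices of
column `s`. -/
theorem induce_star_connected (s : WordNode H) :
    ((tree H).induce {t | s = t ∨ s = parent t}).Connected := by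
  rw [SimpleGraph.connected_iff_exists_forall_reachable]
  refine ⟨⟨s, Or.inl rfl⟩, ?_⟩
  rintro ⟨t, rfl | rfl⟩
  · exact SimpleGraph.Reachable.refl _
  · by_cases ht : t = root H
    · subst ht
      exact SimpleGraph.Reachable.refl _
    · refine SimpleGraph.Adj.reachable ?_
      exact (adj_parent ht).symm

theorem induce_singleton_connected (s : WordNode H) {T : Set (WordNode H)} (hs : s ∈ T)
    (hT : ∀ t ∈ T, t = s) : ((tree H).induce T).Connected := by
  rw [SimpleGraph.connected_iff_exists_forall_reachable]
  refine ⟨⟨s, hs⟩, ?_⟩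
  rintro ⟨t, ht⟩
  obtain rfl := hT t ht
  exact SimpleGraph.Reachable.refl _

theorem induce_univ_connected {T : Set (WordNode H)} (hT : ∀ t, t ∈ T) :
    ((tree H).induce T).Connected := by
  obtain rfl : T = Set.univ := Set.eq_univ_of_forall hT
  exact (SimpleGraph.induceUnivIso (tree H)).connected_iff.2 tree_connected

end WordNode

theorem treewidth_le_of_decomposition {V : Type*} [Finite V] {G : SimpleGraph V} {w : ℕ}
    (D : TreeDecomposition G) (h : ∀ t, (D.bag t).card ≤ w + 1) : treewidth G ≤ w :=
  Nat.sInf_le ⟨D, h⟩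

/-! ### Tree decompositions of the product and of its formula -/

section Comap

open WordNode

variable {V : Type*} {p H : ℕ} {f : V → WordNode H × Fin p}

/-- The copy in `V` of a ternary tree times a path. -/
abbrev treePathOn (f : V → WordNode H × Fin p) : SimpleGraph V :=
  (treePath p).comap fun v => ((f v).1.1, (f v).2)

theorem injective_coe_fst (hf : Function.Injective f) :
    Function.Injective fun v => ((f v).1.1, (f v).2) := by
  intro u v h
  have h := Prod.mk.inj h
  exact hf (Prod.ext (Subtype.ext h.1) h.2)

theorem fst_eq_or_eq_parent_of_adj {u v : V} (h : (treePathOn f).Adj u v) :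
    (f v).1 = (f u).1 ∨ (f v).1 = parent (f u).1 ∨ (f u).1 = parent (f v).1 := by
  have h : (treePath p).Adj _ _ := h
  rw [SimpleGraph.boxProd_adj] at h
  rcases h with ⟨h, -⟩ | ⟨-, h⟩
  · rcases eq_parent_of_adj (show (tree H).Adj (f u).1 (f v).1 from h) with ⟨-, h⟩ | ⟨-, h⟩
    · exact Or.inr (Or.inl h)
    · exact Or.inr (Or.inr h)
  · exact Or.inl (Subtype.ext h.symm)

open Classical in
theorem card_filter_star_le [Fintype V] (hf : Function.Injective f) (t : WordNode H) :
    (Finset.univ.filter fun v => (f v).1 = t ∨ (f v).1 = parent t).card ≤ 2 * p := by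
  have : (({t, parent t} : Finset (WordNode H)) ×ˢ (Finset.univ : Finset (Fin p))).card ≤
      2 * p := by
    rw [Finset.card_product, Finset.card_univ, Fintype.card_fin]
    exact Nat.mul_le_mul_right p Finset.card_le_two
  refine (Finset.card_le_card_of_injOn f (fun v hv => ?_) hf.injOn).trans this
  have := (Finset.mem_filter.1 hv).2
  simp only [Finset.coe_product, Finset.coe_insert, Finset.coe_singleton, Finset.coe_univ,
    Set.mem_prod, Set.mem_insert_iff, Set.mem_singleton_iff, Set.mem_univ, and_true]
  exact this

theorem treewidth_treePathOn_le [Fintype V] (hf : Function.Injective f) :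
    treewidth (treePathOn f) ≤ 2 * p := by
  classical
  refine treewidth_le_of_decomposition
    { Node := WordNode H
      finite_node := WordNode.finite
      tree := tree H
      isTree := tree_isTree
      bag := fun t => Finset.univ.filter fun v => (f v).1 = t ∨ (f v).1 = parent t
      vertex_mem := fun v => ⟨(f v).1, by simp⟩
      edge_mem := ?_
      connected := ?_ } fun t => (card_filter_star_le hf t).trans (by omega)
  · intro u v huv
    rcases fst_eq_or_eq_parent_of_adj huv with h | h | h
    · exact ⟨(f u).1, by simp, by simp [h]⟩
    · exact ⟨(f u).1, by simp, by simp [h]⟩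
    · exact ⟨(f v).1, by simp [h], by simp⟩
  · intro v
    have h : {t | v ∈ Finset.univ.filter fun v => (f v).1 = t ∨ (f v).1 = parent t} =
        {t | (f v).1 = t ∨ (f v).1 = parent t} := by ext; simp
    rw [h]
    exact induce_star_connected (f v).1

/-- The clause `C` consists of two variables from the column `t` and its parent column, at least one
of them from the column `t`. -/
def ClauseAt [DecidableEq V] (f : V → WordNode H × Fin p) (C : Clause (V × Fin 2)) (t : WordNode H) : Prop :=
  ∃ u v : V × Fin 2, (starGraph (treePathOn f)).Adj u v ∧ C = {(u, true), (v, true)} ∧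
    (f u.1).1 = t ∧ ((f v.1).1 = t ∨ (f v.1).1 = parent t)

theorem ClauseAt.fst_eq [DecidableEq V] {C : Clause (V × Fin 2)} {t : WordNode H}
    (h : ClauseAt f C t) {x : V × Fin 2} {s : Bool} (hx : (x, s) ∈ C) : (f x.1).1 = t ∨ (f x.1).1 = parent t := by
  obtain ⟨u, v, -, hC, hu, hv⟩ := h
  have : (x, s) = (u, true) ∨ (x, s) = (v, true) := by
    rw [hC] at hx
    simpa using hx
  rcases this with h | h
  · obtain rfl : x = u := congrArg Prod.fst h
    exact Or.inl hu
  · obtain rfl : x = v := congrArg Prod.fst h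
    exact hv

/-- Each of the two nodes equals the other or its parent. So an edge clause sits in one bag only,
and its connectivity condition is trivial. -/
theorem ClauseAt.unique [DecidableEq V] {C : Clause (V × Fin 2)} {s t : WordNode H}
    (hs : ClauseAt f C s) (ht : ClauseAt f C t) : s = t := by
  obtain ⟨u, v, -, hC, rfl, -⟩ := id hs
  obtain ⟨u', v', -, hC', rfl, -⟩ := id ht
  exact eq_of_mutual_parent (ht.fst_eq (s := true) (by rw [hC]; simp))
    (hs.fst_eq (s := true) (by rw [hC']; simp))

theorem exists_clauseAt [DecidableEq V] {u v : V × Fin 2}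
    (h : (starGraph (treePathOn f)).Adj u v) : ∃ t, ClauseAt f {(u, true), (v, true)} t := by
  rcases fst_eq_or_eq_parent_of_adj h.1 with e | e | e
  · exact ⟨_, u, v, h, rfl, rfl, Or.inl e⟩
  · exact ⟨_, u, v, h, rfl, rfl, Or.inr e⟩
  · exact ⟨_, v, u, h.symm, Finset.pair_comm _ _, rfl, Or.inr e⟩

theorem mem_psi_iff [Fintype V] [DecidableEq V] (G : SimpleGraph V) (C : Clause (V × Fin 2)) :
    C ∈ psi G ↔ (∃ u v, (starGraph G).Adj u v ∧ C = {(u, true), (v, true)}) ∨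
      C = negCopyClause V 0 ∨ C = negCopyClause V 1 := by
  simp only [psi, edgeCNF, Finset.mem_union, Finset.mem_image, Finset.mem_filter, Finset.mem_univ,
    true_and, Finset.mem_insert, Finset.mem_singleton, Prod.exists (α := V × Fin 2)]
  refine or_congr_left (exists_congr fun u => exists_congr fun v => and_congr_right fun _ => ?_)
  exact eq_comm

open Classical in
theorem card_filter_clauseAt_le [Fintype V] [DecidableEq V] (hf : Function.Injective f)
    (t : WordNode H) :
    (Finset.univ.filter fun C : ↥(psi (treePathOn f)) =>
      (C.1 = negCopyClause V 0 ∨ C.1 = negCopyClause V 1) ∨ ClauseAt f C.1 t).card ≤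
      2 + 12 * p := by
  obtain ⟨N, hN, hadj⟩ := exists_neighbors_treePath (injective_coe_fst hf)
  let U : Finset (V × Fin 2) := (Finset.univ.filter fun v => (f v).1 = t) ×ˢ Finset.univ
  have hU : U.card ≤ 2 * p := by
    have : (Finset.univ.filter fun v => (f v).1 = t).card ≤ p := by
      refine (Finset.card_le_card_of_injOn (t := Finset.univ) (fun v => (f v).2)
        (fun _ _ => Finset.mem_univ _) ?_).trans (by simp)
      intro u hu v hv h
      exact hf (Prod.ext ((Finset.mem_filter.1 hu).2.trans (Finset.mem_filter.1 hv).2.symm) h)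
    rw [Finset.card_product, Finset.card_univ, Fintype.card_fin]
    omega
  -- Column `t` holds `2 * p` variables, each with at most 6 neighbors; `u.2 + 1` is the other index
  -- in `Fin 2`.
  let E : Finset (Clause (V × Fin 2)) := U.biUnion fun u =>
    (N u.1).image fun v => {(u, true), ((v, u.2 + 1), true)}
  have hE : E.card ≤ U.card * 6 := Finset.card_biUnion_le_card_mul _ _ _ fun u _ =>
    Finset.card_image_le.trans (hN u.1)
  have hcard : (({negCopyClause V 0, negCopyClause V 1} : Finset (Clause (V × Fin 2))) ∪ E).card ≤
      2 + 12 * p := by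
    have h₁ := Finset.card_union_le
      ({negCopyClause V 0, negCopyClause V 1} : Finset (Clause (V × Fin 2))) E
    have h₂ := Finset.card_le_two (a := negCopyClause V 0) (b := negCopyClause V 1)
    omega
  refine (Finset.card_le_card_of_injOn Subtype.val (fun C hC => ?_)
    Subtype.val_injective.injOn).trans hcard
  rcases (Finset.mem_filter.1 hC).2 with h | ⟨u, v, huv, hCuv, hu, -⟩
  · exact Finset.mem_union_left _ (by simpa using h)
  · refine Finset.mem_union_right _ (Finset.mem_biUnion.2 ⟨u, ?_, Finset.mem_image.2 ⟨v.1, ?_, ?_⟩⟩)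
    · exact Finset.mem_product.2 ⟨Finset.mem_filter.2 ⟨Finset.mem_univ _, hu⟩, Finset.mem_univ _⟩
    · exact hadj _ _ huv.1
    · have hfin : ∀ a b : Fin 2, a ≠ b → a + 1 = b := by decide
      rw [hCuv, hfin _ _ huv.2]

/-- A bag holds the at most `4 * p` variables over a node and its parent, the at most `12 * p` edge
clauses located at the node, and both long clauses. As `p` is positive, `16 * p + 2 ≤ 20 * p + 1`.
-/
theorem incidenceTreewidth_psi_treePathOn_le [Fintype V] [DecidableEq V] (hp : 0 < p)
    (hf : Function.Injective f) :
    CNF.incidenceTreewidth (psi (treePathOn f)) ≤ 20 * p := by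
  classical
  let φ := psi (treePathOn f)
  let long : Clause (V × Fin 2) → Prop := fun C => C = negCopyClause V 0 ∨ C = negCopyClause V 1
  let bagVars : WordNode H → Finset ↥(CNF.vars φ) := fun t =>
    Finset.univ.filter fun x => (f x.1.1).1 = t ∨ (f x.1.1).1 = parent t
  let bagClauses : WordNode H → Finset ↥φ := fun t =>
    Finset.univ.filter fun C => long C.1 ∨ ClauseAt f C.1 t
  have hvars : ∀ t x, x ∈ bagVars t ↔ (f x.1.1).1 = t ∨ (f x.1.1).1 = parent t := by
    simp [bagVars]
  have hclauses : ∀ t C, C ∈ bagClauses t ↔ long C.1 ∨ ClauseAt f C.1 t := by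
    simp [bagClauses]
  have hcover : ∀ C : ↥φ, long C.1 ∨ ∃ t, ClauseAt f C.1 t := by
    rintro ⟨C, hC⟩
    rcases (mem_psi_iff _ C).1 hC with ⟨u, v, huv, rfl⟩ | h
    · exact Or.inr (exists_clauseAt huv)
    · exact Or.inl h
  have hedge : ∀ (x : ↥(CNF.vars φ)) (C : ↥φ), (∃ s : Bool, (x.1, s) ∈ C.1) →
      ∃ t, x ∈ bagVars t ∧ C ∈ bagClauses t := by
    rintro x C ⟨s, hs⟩
    rcases hcover C with h | ⟨t, h⟩
    · exact ⟨(f x.1.1).1, (hvars _ _).2 (Or.inl rfl), (hclauses _ _).2 (Or.inl h)⟩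
    · exact ⟨t, (hvars _ _).2 (h.fst_eq hs), (hclauses _ _).2 (Or.inr h)⟩
  have hbagVars : ∀ t, (bagVars t).card ≤ 4 * p := by
    intro t
    have h : ((Finset.univ.filter fun v => (f v).1 = t ∨ (f v).1 = parent t) ×ˢ
        (Finset.univ : Finset (Fin 2))).card ≤ 4 * p := by
      have := card_filter_star_le hf t
      rw [Finset.card_product, Finset.card_univ, Fintype.card_fin]
      omega
    refine (Finset.card_le_card_of_injOn Subtype.val (fun x hx => ?_)
      Subtype.val_injective.injOn).trans h
    exact Finset.mem_product.2 ⟨Finset.mem_filter.2 ⟨Finset.mem_univ _, (hvars _ _).1 hx⟩,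
      Finset.mem_univ _⟩
  refine treewidth_le_of_decomposition
    { Node := WordNode H
      finite_node := WordNode.finite
      tree := tree H
      isTree := tree_isTree
      bag := fun t => (bagVars t).disjSum (bagClauses t)
      vertex_mem := ?_
      edge_mem := ?_
      connected := ?_ } fun t => ?_
  · rintro (x | C)
    · exact ⟨(f x.1.1).1, Finset.inl_mem_disjSum.2 ((hvars _ _).2 (Or.inl rfl))⟩
    · rcases hcover C with h | ⟨t, h⟩
      · exact ⟨root H, Finset.inr_mem_disjSum.2 ((hclauses _ _).2 (Or.inl h))⟩
      · exact ⟨t, Finset.inr_mem_disjSum.2 ((hclauses _ _).2 (Or.inr h))⟩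
  · rintro (x | C) (y | D) h
    · exact h.elim
    · obtain ⟨t, hx, hD⟩ := hedge x D h
      exact ⟨t, Finset.inl_mem_disjSum.2 hx, Finset.inr_mem_disjSum.2 hD⟩
    · obtain ⟨t, hy, hC⟩ := hedge y C h
      exact ⟨t, Finset.inr_mem_disjSum.2 hC, Finset.inl_mem_disjSum.2 hy⟩
    · exact h.elim
  · rintro (x | C)
    · have h : {t | Sum.inl x ∈ (bagVars t).disjSum (bagClauses t)} =
          {t | (f x.1.1).1 = t ∨ (f x.1.1).1 = parent t} := by
        ext t
        exact Finset.inl_mem_disjSum.trans (hvars t x)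
      rw [h]
      exact induce_star_connected _
    · by_cases hC : long C.1
      · exact induce_univ_connected fun t =>
          Finset.inr_mem_disjSum.2 ((hclauses _ _).2 (Or.inl hC))
      · obtain ⟨s, hs⟩ := (hcover C).resolve_left hC
        refine induce_singleton_connected s
          (Finset.inr_mem_disjSum.2 ((hclauses _ _).2 (Or.inr hs))) fun t ht => ?_
        have := (hclauses t C).1 (Finset.inr_mem_disjSum.1 ht)
        exact (this.resolve_left hC).unique hs
  · have h₁ := hbagVars t
    have h₂ : (bagClauses t).card ≤ 2 + 12 * p := by
      convert card_filter_clauseAt_le hf t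
    rw [Finset.card_disjSum]
    omega

end Comap

/-! ### Numerical estimates and the theorem -/

theorem noIsolated_treePathOn {V : Type*} {p H : ℕ} (e : V ≃ WordNode H × Fin p) (hH : 0 < H) :
    NoIsolated (treePathOn e) := by
  have hadj : ∀ (s t : WordNode H) (i : Fin p), (WordNode.tree H).Adj s t →
      (treePathOn e).Adj (e.symm (s, i)) (e.symm (t, i)) := by
    intro s t i h
    simp only [SimpleGraph.comap_adj, e.apply_symm_apply]
    exact SimpleGraph.boxProd_adj.2 (Or.inl ⟨h, rfl⟩)
  intro v
  obtain ⟨⟨t, i⟩, rfl⟩ := e.symm.surjective v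
  by_cases ht : t = WordNode.root H
  · subst ht
    exact ⟨_, hadj _ ⟨[0], hH⟩ i (Or.inr ⟨0, rfl⟩)⟩
  · exact ⟨_, hadj _ _ i (WordNode.adj_parent ht)⟩

theorem card_wordNode_prod (H p : ℕ) :
    Nat.card (WordNode H × Fin p) = (words H).card * p := by
  have : Nat.card (WordNode H) = (words H).card := by
    rw [← Set.ncard_coe_finset]
    exact congrArg Set.ncard (by ext l; simp [mem_words])
  rw [Nat.card_prod, this, Nat.card_eq_fintype_card, Fintype.card_fin]

/-- From n ≤ 4 ^ (2p + h) · p and log 2 < 1 the tree contributes at most 2(2p + h) ≤ 4h, and log p <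
p ≤ h supplies the fifth `h`. -/
theorem log_card_le {p h n : ℕ} (hp : 0 < p) (hh : 2 * p ≤ h)
    (hn : n = (words (2 * p + h)).card * p) : Real.log n ≤ 5 * h := by
  have hn0 : 0 < n := by
    rw [hn]
    exact Nat.mul_pos (lt_of_lt_of_le (Nat.succ_pos _) (succ_le_card_words _)) hp
  have hle : (n : ℝ) ≤ 4 ^ (2 * p + h) * p := by
    rw [hn]
    exact_mod_cast Nat.mul_le_mul_right p (card_words_le _)
  have hp' : (0 : ℝ) < p := by exact_mod_cast hp
  have h₁ := Real.log_le_log (by exact_mod_cast hn0) hle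
  rw [Real.log_mul (by positivity) hp'.ne', Real.log_pow,
    show (4 : ℝ) = 2 ^ 2 by norm_num, Real.log_pow] at h₁
  have h₂ := Real.log_two_lt_d9
  have h₃ := Real.log_le_sub_one_of_pos hp'
  have h₄ : (2 * p : ℝ) ≤ h := by exact_mod_cast hh
  push_cast at h₁
  have h₅ : (2 * p + h : ℝ) * (2 * Real.log 2) ≤ (2 * p + h) * 2 :=
    mul_le_mul_of_nonneg_left (by linarith) (by positivity)
  linarith

theorem theorem3p1 :
    ∃ c : ℝ, 0 < c ∧ ∃ K : Set ℕ, K.Infinite ∧ ∀ k ∈ K,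
      {n : ℕ | ∃ G : SimpleGraph (Fin n),
        NoIsolated G ∧
        treewidth G ≤ k ∧
        c * k * Real.log n ≤ lsimWidth G ∧
        CNF.incidenceTreewidth (psi G) ≤ k ∧
        ∀ B : ConjFBDD (Fin n × Fin 2), B.IsConjOBDD → B.Represents (psi G) →
          ((CNF.vars (psi G)).card : ℝ) ^ (c * (k : ℝ)) ≤ B.size}.Infinite := by
  -- With k = 20p the product c · k is p / 2000, small enough to absorb the losses 48 and 5 or 6 in
  -- both bounds.
  refine ⟨1 / 40000, by norm_num, Set.range fun p => 20 * (p + 1),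
    Set.infinite_range_of_injective fun a b h => by simpa using h, ?_⟩
  rintro _ ⟨p', rfl⟩
  obtain ⟨p, hpp⟩ : ∃ p, p = p' + 1 := ⟨_, rfl⟩
  have hp : 0 < p := by omega
  simp only [← hpp]
  refine Set.infinite_of_forall_exists_gt fun a => ?_
  -- The term `2 * p` is for the logarithm bound, 2000 makes h · p / 48 large, and `a` makes `n`
  -- exceed `a`.
  let h := 2 * p + 2000 + a
  have hh : 2 * p + 2000 ≤ h := Nat.le_add_right _ _
  let H := 2 * p + h
  let n := (words H).card * p
  have han : a < n := by
    have h₁ := succ_le_card_words H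
    have h₂ : (words H).card ≤ n := Nat.le_mul_of_pos_right _ hp
    omega
  have := WordNode.finite (H := H)
  have e : Fin n ≃ WordNode H × Fin p :=
    (finCongr (card_wordNode_prod H p).symm).trans (Finite.equivFin _).symm
  have hinj := injective_coe_fst e.injective
  have hrange : ∀ x : List (Fin 3) × Fin p,
      (∃ v, ((e v).1.1, (e v).2) = x) ↔ x.1.length ≤ 2 * p + h := by
    intro x
    constructor
    · rintro ⟨v, rfl⟩
      exact (e v).1.2
    · intro hx
      exact ⟨e.symm (⟨x.1, hx⟩, x.2), by rw [e.apply_symm_apply]⟩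
  have hlog : Real.log n ≤ 5 * h := log_card_le hp (by omega) rfl
  have hp1 : (1 : ℝ) ≤ p := by exact_mod_cast hp
  have hh1 : (2000 : ℝ) ≤ h := by exact_mod_cast (by omega : 2000 ≤ h)
  have hhp : (2000 : ℝ) ≤ h * p := by nlinarith
  have hexp : (1 / 40000 : ℝ) * ((20 * p : ℕ) : ℝ) = p / 2000 := by
    push_cast
    ring
  refine ⟨n, ⟨treePathOn e, noIsolated_treePathOn e (by omega), ?_, ?_, ?_, ?_⟩, han⟩
  · exact (treewidth_treePathOn_le e.injective).trans (by omega)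
  · have hw : (h : ℝ) * p ≤ 48 * lsimWidth (treePathOn e) := by
      exact_mod_cast le_lsimWidth_treePath hp h hinj hrange
    rw [hexp]
    have : (p / 2000 : ℝ) * Real.log n ≤ p / 2000 * (5 * h) :=
      mul_le_mul_of_nonneg_left hlog (by positivity)
    linarith
  · exact incidenceTreewidth_psi_treePathOn_le hp e.injective
  · intro B hB hrep
    obtain ⟨m, hm, hsize⟩ := two_pow_le_size_treePath hp h hinj hrange hB hrep
    have hm' : (h : ℝ) * p ≤ 48 * m := by exact_mod_cast hm
    -- One unit of the exponent pays for the additive 2: from 2 ^ (m + 1) ≤ |B| + 2 and 2 ≤ 2 ^ m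
    -- follows 2 ^ m ≤ |B|.
    obtain ⟨m, rfl⟩ : ∃ m', m = m' + 1 := Nat.exists_eq_succ_of_ne_zero (by
      rintro rfl
      norm_num at hm'
      linarith)
    have hm2 : 2 ≤ 2 ^ m := by
      refine Nat.le_self_pow ?_ 2
      rintro rfl
      norm_num at hm'
      linarith
    have hsize' : (2 : ℝ) ^ m ≤ B.size := by
      rw [pow_succ] at hsize
      exact_mod_cast (by omega : 2 ^ m ≤ B.size)
    have hn0 : (0 : ℝ) < n := by exact_mod_cast (Nat.zero_le a).trans_lt han
    refine le_trans ?_ hsize'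
    rw [hexp, psi_vars, Finset.card_univ, Fintype.card_prod, Fintype.card_fin, Fintype.card_fin,
      Nat.cast_mul, Nat.cast_ofNat, Real.rpow_def_of_pos (by positivity),
      ← Real.le_log_iff_exp_le (by positivity), Real.log_pow,
      Real.log_mul hn0.ne' (by norm_num)]
    have h₂ := Real.log_two_lt_d9
    have h₃ := Real.log_two_gt_d9
    -- The formula has 2n variables, and log (2n) ≤ 5h + 1 ≤ 6h.
    have h₄ : (Real.log n + Real.log 2) * (p / 2000) ≤ (6 * h) * (p / 2000) :=
      mul_le_mul_of_nonneg_right (by linarith) (by positivity)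
    push_cast at hm'
    have h₅ : (m : ℝ) * (1 / 2) ≤ m * Real.log 2 :=
      mul_le_mul_of_nonneg_left (by linarith) (by positivity)
    linarith
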